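/- For a finite group $G$, a prime $p$ and $x\in G$, let $n_p(G)$ be the number of Sylow $p$-subgroups of $G$ and $\lambda_G(x)$ the number of Sylow $p$-subgroups of $G$ containing $x$. A group $G$ is almost simple if, up to isomorphism, $\operatorname{Inn}(S)\le G\le\operatorname{Aut}(S)$ for some nonabelian simple group $S$. Theorem 1.2. Let $p$ be a prime. The inequality $$\Bigl(\prod_{x\in P}\lambda_G(x)\Bigr)^{1/|P|}\le n_p(G)^{1/p}\qquad\text{for every Sylow } p\text{-subgroup } P \text{ of } G$$ holds for every finite group $G$ if and only if it holds for every finite almost simple group $G$. -/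

import Mathlib

universe u

/-- A group `G` is almost simple if `Inn S ≤ G ≤ Aut S`, up to isomorphism, for some
nonabelian simple group `S`: there is an embedding of `G` in `Aut S` whose image contains all
inner automorphisms of `S`. (Then `S` is isomorphic to a subgroup of `G`, so it costs nothing to
take it in the universe of `G`, and it is finite if `G` is.) -/
def IsAlmostSimple (G : Type u) [Group G] : Prop :=
  ∃ (S : Type u) (_ : Group S), IsSimpleGroup S ∧ (∃ a b : S, a * b ≠ b * a) ∧
    ∃ f : G →* MulAut S, Function.Injective f ∧ (MulAut.conj : S →* MulAut S).range ≤ f.range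

/-- `n_p(G)`, the number of Sylow `p`-subgroups of `G`. -/
noncomputable def numSylow (p : ℕ) (G : Type u) [Group G] : ℕ :=
  Nat.card (Sylow p G)

/-- `λ_G(x)`, the number of Sylow `p`-subgroups of `G` that contain `x`. -/
noncomputable def numSylowContaining (p : ℕ) {G : Type u} [Group G] (x : G) : ℕ :=
  Nat.card {Q : Sylow p G // x ∈ Q}

/-- The inequality `(∏_{x ∈ P} λ_G(x)) ^ (1 / |P|) ≤ n_p(G) ^ (1 / p)`, for every Sylow
`p`-subgroup `P` of `G`. -/
def SylowMeanInequality (p : ℕ) (G : Type u) [Group G] : Prop :=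
  ∀ P : Sylow p G,
    (∏ᶠ x : P, (numSylowContaining p (x : G) : ℝ)) ^ (1 / (Nat.card P : ℝ)) ≤
      (numSylow p G : ℝ) ^ (1 / (p : ℝ))

/-! For subgroups `N` and `P` and a set `A`, let c_N(A) be the number of n in N with n⁻¹An ⊆ P. If P
is Sylow in G, then c_G(x) = λ_G(x)·|N_G(P)|, c_G(1) = |G| and c_G(P) = |N_G(P)|, so the claim is
equivalent to (∏ c_G(x))^p ≤ |G|^|P| · c_G(P)^(|P|(p-1)). In this form it makes sense for any `N`
and is multiplicative: if N is normal and A ⊆ P, then c_G(A) = c_{G/N}(AN/N)·c_N(A)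
(`ncard_conjInto_top`). Hence G inherits the inequality from G/N and from the pair (N, P). If P
normalizes N, passing from N to PN multiplies all counts by the same factor, so (N, P) follows from
the group PN.

By induction on |G|, only the case where PN = G for every nontrivial normal N remains. Let P ≠ G and
let N be minimal normal; G/N is a p-group, for which equality holds, so (N, P) is what is needed.

If N is abelian, then P ∩ N = 1 and the counts are orders of fixed subgroups. Unless P acts
trivially, some z in P acts nontrivially and centrally in the image of P in Aut(N), and minimality
makes it fixed-point-free. The fixed subgroups of x, xz, ..., xz^(p-1) are then independent, so
their orders multiply to at most |N|; the product over x is the claim.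

If N is nonabelian simple, then G is almost simple. Otherwise let S < N be minimal normal in N. Its
normalizer in P lies in a normal subgroup M of index p, and N is a direct product of p conjugates of
N₁, the product of the M-conjugates of S. The action of P on N is coinduced from that of M on N₁, so
(N, P) follows from (N₁, M) (`TwistedMeanInequality.of_coinduced`), and that from the proper
subgroup MN₁. -/

/-- The elements of `N` that conjugate the set `A` into `P`. -/
def conjInto {G : Type*} [Group G] (N P : Subgroup G) (A : Set G) : Set G :=
  {n | n ∈ N ∧ ∀ a ∈ A, n⁻¹ * a * n ∈ P}

/-- The mean inequality for the numbers of elements of `N` that conjugate `x ∈ P` into `P`. -/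
def ConjMeanInequality (p : ℕ) {G : Type*} [Group G] (N P : Subgroup G) : Prop :=
  (∏ᶠ x : P, (conjInto N P {(x : G)}).ncard) ^ p ≤
    Nat.card N ^ Nat.card P * (conjInto N P P).ncard ^ (Nat.card P * (p - 1))

theorem Set.ncard_eq_mul_of_fiber {α β : Type*} [Finite α] [Finite β] (φ : α → β) (s : Set α)
    (t : Set β) (c : ℕ) (hst : ∀ a ∈ s, φ a ∈ t) (h : ∀ b ∈ t, {a | a ∈ s ∧ φ a = b}.ncard = c) :
    s.ncard = t.ncard * c := by
  classical
  cases nonempty_fintype α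
  cases nonempty_fintype β
  rw [Set.ncard_eq_toFinset_card' s, Set.ncard_eq_toFinset_card' t,
    Finset.card_eq_sum_card_fiberwise (f := φ) (t := t.toFinset) (by intro a; simpa using hst a)]
  rw [Finset.sum_const_nat]
  intro b hb
  rw [← h b (by simpa using hb), Set.ncard_eq_toFinset_card']
  congr 1
  ext a
  simp

theorem Fintype.prod_comp_hom_of_surjective {A B M : Type*} [Group A] [Group B] [Fintype A]
    [Fintype B] [CommMonoid M] (φ : A →* B) (hφ : Function.Surjective φ) (F : B → M) :
    ∏ a, F (φ a) = (∏ b, F b) ^ Nat.card φ.ker := by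
  classical
  rw [Finset.prod_comp F φ, Finset.image_univ_of_surjective hφ, ← Finset.prod_pow]
  refine Finset.prod_congr rfl fun b _ => ?_
  congr 1
  rw [MonoidHom.card_fiber_eq_of_mem_range φ (hφ b) (hφ 1), Nat.card_eq_fintype_card,
    Fintype.card_subtype]
  simp [MonoidHom.mem_ker]

/-! ### Counting conjugators: enlarging `N`, changing `P`, passing to quotients -/

section conjInto

variable {G : Type*} [Group G]

theorem mem_conjInto {N P : Subgroup G} {A : Set G} {n : G} :
    n ∈ conjInto N P A ↔ n ∈ N ∧ ∀ a ∈ A, n⁻¹ * a * n ∈ P := Iff.rfl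

theorem conjInto_empty (N P : Subgroup G) : conjInto N P ∅ = N := by
  ext; simp [mem_conjInto]

theorem conjInto_singleton_one (N P : Subgroup G) : conjInto N P {1} = N := by
  ext; simp [mem_conjInto, P.one_mem]

theorem ncard_conjInto_map_left [Finite G] (N P : Subgroup G) [N.Normal] (A : Set G) (h : G) :
    (conjInto N P ((fun a => h⁻¹ * a * h) '' A)).ncard =
      (conjInto N (P.map (MulAut.conj h).toMonoidHom) A).ncard := by
  refine Set.ncard_congr (fun n _ => h * n * h⁻¹) ?_ ?_ ?_
  · rintro n ⟨hn, hA⟩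
    refine ⟨Subgroup.Normal.conj_mem ‹_› _ hn _, fun a ha => ?_⟩
    refine ⟨_, hA _ ⟨a, ha, rfl⟩, ?_⟩
    simp [mul_assoc]
  · intro a b _ _ hab
    simpa using hab
  · rintro n ⟨hn, hA⟩
    refine ⟨h⁻¹ * n * h, ⟨by simpa using Subgroup.Normal.conj_mem ‹_› _ hn h⁻¹, ?_⟩, by group⟩
    rintro _ ⟨a, ha, rfl⟩
    obtain ⟨q, hq, hq'⟩ := hA a ha
    have : q = h⁻¹ * (n⁻¹ * a * n) * h := by
      rw [← hq']; simp [mul_assoc]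
    have e : (h⁻¹ * n * h)⁻¹ * (h⁻¹ * a * h) * (h⁻¹ * n * h) = q := by rw [this]; group
    rw [e]; exact hq

theorem ncard_conjInto_map_right (N P : Subgroup G) (A : Set G) {n : G} (hn : n ∈ N) :
    (conjInto N (P.map (MulAut.conj n).toMonoidHom) A).ncard = (conjInto N P A).ncard := by
  refine Set.ncard_congr (fun k _ => k * n) ?_ ?_ ?_
  · rintro k ⟨hk, hA⟩
    refine ⟨N.mul_mem hk hn, fun a ha => ?_⟩
    obtain ⟨q, hq, hq'⟩ := hA a ha
    have : q = n⁻¹ * (k⁻¹ * a * k) * n := by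
      rw [← hq']; simp [mul_assoc]
    have e : (k * n)⁻¹ * a * (k * n) = q := by rw [this]; group
    rw [e]; exact hq
  · intro a b _ _ hab
    simpa using hab
  · rintro k ⟨hk, hA⟩
    refine ⟨k * n⁻¹, ⟨N.mul_mem hk (N.inv_mem hn), fun a ha => ⟨_, hA a ha, ?_⟩⟩, by group⟩
    simp [mul_assoc]

/-- A subgroup `P` normalizing `N` multiplies the counts by `|P| / |P ∩ N|` when `N` is enlarged
to `P ⊔ N`. -/
theorem ncard_conjInto_sup_mul [Finite G] {N P : Subgroup G}
    (h : P ≤ Subgroup.normalizer (N : Set G)) (A : Set G) :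
    (conjInto (P ⊔ N) P A).ncard * Nat.card (P ⊓ N : Subgroup G) =
      (conjInto N P A).ncard * Nat.card P := by
  classical
  -- Count the pairs (n, a) in two ways: each product na in PN arises from |P ∩ N| pairs (nt, t⁻¹a).
  have key : (((conjInto N P A) ×ˢ (P : Set G) : Set (G × G))).ncard =
      (conjInto (P ⊔ N) P A).ncard * Nat.card (P ⊓ N : Subgroup G) := by
    refine Set.ncard_eq_mul_of_fiber (fun x : G × G => x.1 * x.2) _ _ _ ?_ ?_
    · rintro ⟨n, a⟩ ⟨⟨hn, hA⟩, ha⟩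
      refine ⟨mul_mem (Subgroup.mem_sup_right hn) (Subgroup.mem_sup_left ha), fun b hb => ?_⟩
      have := P.mul_mem (P.mul_mem (P.inv_mem ha) (hA b hb)) ha
      convert this using 1
      simp [mul_assoc]
    · rintro k ⟨hk, hA⟩
      have hk' : k ∈ ((P ⊔ N : Subgroup G) : Set G) := hk
      rw [sup_comm, Subgroup.coe_mul_of_right_le_normalizer_left _ _ h] at hk'
      obtain ⟨n, hn, a, ha, rfl⟩ := hk'
      symm
      change ((P ⊓ N : Subgroup G) : Set G).ncard = _
      refine Set.ncard_congr (fun t _ => (n * t, t⁻¹ * a)) ?_ ?_ ?_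
      · rintro t ⟨htP, htN⟩
        refine ⟨⟨⟨N.mul_mem hn htN, fun b hb => ?_⟩, P.mul_mem (P.inv_mem htP) ha⟩, by simp⟩
        have hta : t⁻¹ * a ∈ P := P.mul_mem (P.inv_mem htP) ha
        have := P.mul_mem (P.mul_mem hta (hA b hb)) (P.inv_mem hta)
        convert this using 1
        simp [mul_assoc]
      · intro s t _ _ hst
        simpa using (Prod.ext_iff.1 hst).1
      · rintro ⟨m, b⟩ ⟨⟨⟨hm, -⟩, hb⟩, hmb⟩
        simp only at hmb hm hb
        have e : n⁻¹ * m = a * b⁻¹ := by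
          rw [eq_mul_inv_iff_mul_eq, mul_assoc, hmb]; simp
        refine ⟨n⁻¹ * m, ⟨?_, N.mul_mem (N.inv_mem hn) hm⟩, ?_⟩
        · rw [SetLike.mem_coe, e]; exact P.mul_mem ha (P.inv_mem hb)
        · refine Prod.ext (by simp) ?_
          simp only; rw [e]; simp
  rw [← key, Set.ncard_prod]
  rfl

theorem Subgroup.card_sup_mul_card_inf [Finite G] {N P : Subgroup G}
    (h : P ≤ Subgroup.normalizer (N : Set G)) :
    Nat.card (P ⊔ N : Subgroup G) * Nat.card (P ⊓ N : Subgroup G) = Nat.card N * Nat.card P := by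
  have := ncard_conjInto_sup_mul h (∅ : Set G)
  simp only [conjInto_empty] at this
  exact this

theorem Subgroup.relIndex_sup_of_le_normalizer [Finite G] {N P : Subgroup G}
    (h : P ≤ Subgroup.normalizer (N : Set G)) : P.relIndex (P ⊔ N) = P.relIndex N := by
  have h1 := Subgroup.card_sup_mul_card_inf h
  have h2 := Subgroup.relIndex_mul_relIndex ⊥ P (P ⊔ N) bot_le le_sup_left
  have h3 := Subgroup.relIndex_mul_relIndex ⊥ (P ⊓ N) N bot_le inf_le_right
  simp only [Subgroup.relIndex_bot_left, Subgroup.inf_relIndex_right] at h2 h3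
  have hP : 0 < Nat.card P := Nat.card_pos
  have hT : 0 < Nat.card (P ⊓ N : Subgroup G) := Nat.card_pos
  rw [← h2, ← h3] at h1
  refine Nat.eq_of_mul_eq_mul_left (Nat.mul_pos hP hT) ?_
  linarith

theorem conjMeanInequality_iff (p : ℕ) (N P : Subgroup G) [Fintype P] :
    ConjMeanInequality p N P ↔ (∏ x : P, (conjInto N P {(x : G)}).ncard) ^ p ≤
      Nat.card N ^ Nat.card P * (conjInto N P P).ncard ^ (Nat.card P * (p - 1)) := by
  rw [ConjMeanInequality, finprod_eq_prod_of_fintype]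

/-- Since |N| is itself the count for the empty set, both sides are homogeneous of degree p·|P| in
the counts, and the common factor |P| / |P ∩ N| cancels. -/
theorem ConjMeanInequality.of_sup [Finite G] {p : ℕ} (hp : 0 < p) {N P : Subgroup G}
    (h : P ≤ Subgroup.normalizer (N : Set G)) (H : ConjMeanInequality p (P ⊔ N) P) :
    ConjMeanInequality p N P := by
  cases nonempty_fintype P
  rw [conjMeanInequality_iff] at H ⊢
  have hc := Subgroup.card_sup_mul_card_inf h
  have hf := ncard_conjInto_sup_mul h
  set a := Nat.card (P ⊓ N : Subgroup G)
  set b := Nat.card P with hb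
  have hbpos : 0 < b := Nat.card_pos
  have hprod : (∏ x : P, (conjInto (P ⊔ N) P {(x : G)}).ncard) * a ^ b =
      (∏ x : P, (conjInto N P {(x : G)}).ncard) * b ^ b := by
    have : ∀ c : ℕ, c ^ b = ∏ _x : P, c := fun c => by
      simp [hb, Nat.card_eq_fintype_card]
    rw [this a, this b, ← Finset.prod_mul_distrib, ← Finset.prod_mul_distrib]
    exact Finset.prod_congr rfl fun x _ => hf _
  obtain ⟨q, rfl⟩ : ∃ q, p = q + 1 := ⟨p - 1, by omega⟩
  simp only [Nat.add_sub_cancel] at H ⊢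
  refine Nat.le_of_mul_le_mul_right (c := (b ^ b) ^ (q + 1)) ?_ (by positivity)
  calc _ = (∏ x : P, (conjInto (P ⊔ N) P {(x : G)}).ncard) ^ (q + 1) * (a ^ b) ^ (q + 1) := by
        rw [← mul_pow, ← hprod, mul_pow]
    _ ≤ _ := Nat.mul_le_mul_right _ H
    _ = (Nat.card (P ⊔ N : Subgroup G) * a) ^ b *
          ((conjInto (P ⊔ N) P P).ncard * a) ^ (b * q) := by ring
    _ = _ := by rw [hc, hf]; ring

theorem ConjMeanInequality.of_subgroupOf {p : ℕ} {K P : Subgroup G} (hPK : P ≤ K)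
    (H : ConjMeanInequality p ⊤ (P.subgroupOf K)) : ConjMeanInequality p K P := by
  have key : ∀ A : Set G, A ⊆ K → (conjInto K P A).ncard =
      (conjInto ⊤ (P.subgroupOf K) ((↑) ⁻¹' A : Set K)).ncard := by
    intro A hA
    symm
    refine Set.ncard_congr (fun n _ => (n : G)) ?_ ?_ ?_
    · rintro n ⟨-, hn⟩
      exact ⟨n.2, fun a ha => hn ⟨a, hA ha⟩ ha⟩
    · intro a b _ _ hab
      exact Subtype.ext hab
    · rintro n ⟨hn, hn'⟩
      exact ⟨⟨n, hn⟩, ⟨trivial, fun a ha => hn' a ha⟩, rfl⟩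
  have hcard : Nat.card (P.subgroupOf K) = Nat.card P :=
    Nat.card_congr (Subgroup.subgroupOfEquivOfLe hPK).toEquiv
  rw [ConjMeanInequality, hcard, Subgroup.card_top] at H
  rw [ConjMeanInequality, key _ hPK]
  convert H using 2
  swap
  · rfl
  refine finprod_eq_of_bijective (Subgroup.subgroupOfEquivOfLe hPK).symm
    (Subgroup.subgroupOfEquivOfLe hPK).symm.bijective fun x => ?_
  rw [key _ (by simpa using hPK x.2)]
  congr 2
  ext k
  simp [Subtype.ext_iff]

/-- Sylow's theorem in PN gives a conjugator na with n in N and a in P; the factor a normalizes P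
and can be dropped. -/
theorem IsPGroup.exists_le_map_conj_of_le_sup [Finite G] {p : ℕ} [Fact p.Prime]
    {N Q : Subgroup G} [N.Normal] (P : Sylow p G) (hQ : IsPGroup p Q) (h : Q ≤ (P : Subgroup G) ⊔ N) :
    ∃ n ∈ N, Q ≤ (P : Subgroup G).map (MulAut.conj n).toMonoidHom := by
  set K := (P : Subgroup G) ⊔ N
  obtain ⟨R, hR⟩ := (hQ.comap_of_injective K.subtype K.subtype_injective).exists_le_sylow
  obtain ⟨k, hk⟩ := MulAction.exists_smul_eq K (P.subtype (le_sup_left : (P : Subgroup G) ≤ K)) R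
  have hk' : (k : G) ∈ ((P : Subgroup G) ⊔ N : Subgroup G) := k.2
  rw [← SetLike.mem_coe, sup_comm, Subgroup.normal_mul] at hk'
  obtain ⟨n, hn, a, ha, hna⟩ := hk'
  simp only at hna
  refine ⟨n, hn, fun q hq => ?_⟩
  have h1 : (⟨q, h hq⟩ : K) ∈ (R : Subgroup K) := hR hq
  rw [← hk, Sylow.coe_subgroup_smul, Subgroup.mem_pointwise_smul_iff_inv_smul_mem] at h1
  have h2 : (k : G)⁻¹ * q * k ∈ P := by
    have : (↑k)⁻¹ * q * ↑k ∈ (P : Subgroup G) := by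
      simpa [Sylow.coe_subtype, Subgroup.mem_subgroupOf, ← map_inv] using h1
    exact this
  refine ⟨n⁻¹ * q * n, ?_, by simp [mul_assoc]⟩
  have := P.mul_mem (P.mul_mem ha h2) (P.inv_mem ha)
  have e : n⁻¹ * q * n = a * ((k : G)⁻¹ * q * k) * a⁻¹ := by rw [← hna]; group
  rw [e]
  exact this

/-- The p-group P ∩ QN lies in some nQn⁻¹ with n in N. For a in A and k in N with k⁻¹ak in P, both a
and a⁻¹(k⁻¹ak) lie in P ∩ QN, hence k⁻¹ak lies in nQn⁻¹. Replacing Q by this N-conjugate does not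
change the count. -/
theorem ncard_conjInto_le_of_subset [Finite G] {p : ℕ} [Fact p.Prime] {N : Subgroup G} [N.Normal]
    (P Q : Sylow p G) {A : Set G} (hP : A ⊆ P) (hQ : A ⊆ Q) :
    (conjInto N P A).ncard ≤ (conjInto N Q A).ncard := by
  have hB : IsPGroup p ((P : Subgroup G) ⊓ (Q ⊔ N) : Subgroup G) := P.isPGroup'.to_le inf_le_left
  obtain ⟨n, hn, hle⟩ := hB.exists_le_map_conj_of_le_sup Q inf_le_right
  rw [← ncard_conjInto_map_right N Q A hn]
  refine Set.ncard_le_ncard ?_ (Set.toFinite _)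
  rintro k ⟨hk, hkA⟩
  refine ⟨hk, fun a ha => ?_⟩
  set R := (Q : Subgroup G).map (MulAut.conj n).toMonoidHom
  have h1 : a ∈ R := hle ⟨hP ha, Subgroup.mem_sup_left (hQ ha)⟩
  have h2 : a⁻¹ * (k⁻¹ * a * k) ∈ R := by
    refine hle ⟨Subgroup.mul_mem _ (Subgroup.inv_mem _ (hP ha)) (hkA a ha),
      Subgroup.mem_sup_right ?_⟩
    have := N.mul_mem (Subgroup.Normal.conj_mem ‹_› _ (N.inv_mem hk) a⁻¹) hk
    convert this using 1
    group
  simpa using R.mul_mem h1 h2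

theorem ncard_conjInto_eq_of_subset [Finite G] {p : ℕ} [Fact p.Prime] {N : Subgroup G} [N.Normal]
    (P Q : Sylow p G) {A : Set G} (hP : A ⊆ P) (hQ : A ⊆ Q) :
    (conjInto N P A).ncard = (conjInto N Q A).ncard :=
  le_antisymm (ncard_conjInto_le_of_subset P Q hP hQ) (ncard_conjInto_le_of_subset Q P hQ hP)

/-- The fibres over G/N all have the same size. If gN conjugates the image of A into that of P, some
gn with n in N conjugates A into P, so the fibre is a translate of the elements of N conjugating
(gn)⁻¹A(gn) into P. Their number is the count of A into (gn)P(gn)⁻¹, and this Sylow subgroup, which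
also contains A, may be replaced by P. -/
theorem ncard_conjInto_top [Finite G] {p : ℕ} [Fact p.Prime] (N : Subgroup G) [N.Normal]
    (P : Sylow p G) {A : Set G} (hP : A ⊆ P) :
    (conjInto ⊤ P A).ncard =
      (conjInto ⊤ ((P : Subgroup G).map (QuotientGroup.mk' N)) (QuotientGroup.mk' N '' A)).ncard *
        (conjInto N P A).ncard := by
  refine Set.ncard_eq_mul_of_fiber (QuotientGroup.mk' N) _ _ _ ?_ ?_
  · rintro g ⟨-, hg⟩
    refine ⟨trivial, ?_⟩
    rintro _ ⟨a, ha, rfl⟩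
    exact ⟨_, hg a ha, by simp⟩
  · intro q hq
    obtain ⟨g, rfl⟩ := QuotientGroup.mk'_surjective N q
    have hgA : ∀ a ∈ A, g⁻¹ * a * g ∈ (P : Subgroup G) ⊔ N := by
      intro a ha
      have h1 := hq.2 _ ⟨a, ha, rfl⟩
      rw [← map_inv, ← map_mul, ← map_mul, ← Subgroup.mem_comap, Subgroup.comap_map_eq,
        QuotientGroup.ker_mk'] at h1
      exact h1
    have hB : IsPGroup p
        ((P : Subgroup G).map (MulAut.conj g⁻¹).toMonoidHom ⊓ (P ⊔ N) : Subgroup G) :=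
      (P.isPGroup'.map _).to_le inf_le_left
    obtain ⟨n, hn, hle⟩ := hB.exists_le_map_conj_of_le_sup P inf_le_right
    have hA' : ∀ a ∈ A, (g * n)⁻¹ * a * (g * n) ∈ (P : Subgroup G) := by
      intro a ha
      obtain ⟨x, hx, hx'⟩ := hle ⟨⟨a, hP ha, by simp⟩, hgA a ha⟩
      have e : (g * n)⁻¹ * a * (g * n) = x := by
        have : x = n⁻¹ * (g⁻¹ * a * g) * n := by rw [← hx']; simp [mul_assoc]
        rw [this]; group
      rw [e]; exact hx
    have hsub : A ⊆ ((g * n) • P : Sylow p G) := by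
      intro a ha
      exact ⟨_, hA' a ha, by simp [mul_assoc]⟩
    rw [ncard_conjInto_eq_of_subset P ((g * n) • P) hP hsub]
    change _ = (conjInto N ((P : Subgroup G).map (MulAut.conj (g * n)).toMonoidHom) A).ncard
    rw [← ncard_conjInto_map_left]
    symm
    refine Set.ncard_congr (fun k _ => g * n * k) ?_ ?_ ?_
    · rintro k ⟨hk, hkA⟩
      refine ⟨⟨trivial, fun a ha => ?_⟩, ?_⟩
      · have := hkA _ ⟨a, ha, rfl⟩
        have e : (g * n * k)⁻¹ * a * (g * n * k) = k⁻¹ * ((g * n)⁻¹ * a * (g * n)) * k := by group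
        rw [e]; exact this
      · rw [QuotientGroup.mk'_eq_mk']
        refine ⟨(n * k)⁻¹, N.inv_mem (N.mul_mem hn hk), by group⟩
    · intro a b _ _ hab
      simpa using hab
    · rintro k ⟨⟨-, hkA⟩, hk⟩
      rw [eq_comm, QuotientGroup.mk'_eq_mk'] at hk
      obtain ⟨z, hz, rfl⟩ := hk
      refine ⟨n⁻¹ * z, ⟨N.mul_mem (N.inv_mem hn) hz, ?_⟩, by group⟩
      rintro _ ⟨a, ha, rfl⟩
      have := hkA a ha
      have e : (n⁻¹ * z)⁻¹ * ((g * n)⁻¹ * a * (g * n)) * (n⁻¹ * z) = (g * z)⁻¹ * a * (g * z) := by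
        group
      rw [e]; exact this

theorem ConjMeanInequality.of_quotient [Finite G] {p : ℕ} [Fact p.Prime] (N : Subgroup G)
    [N.Normal] (P : Sylow p G)
    (hQ : ConjMeanInequality p ⊤ ((P : Subgroup G).map (QuotientGroup.mk' N)))
    (hN : ConjMeanInequality p N P) : ConjMeanInequality p ⊤ (P : Subgroup G) := by
  cases nonempty_fintype (P : Subgroup G)
  cases nonempty_fintype ((P : Subgroup G).map (QuotientGroup.mk' N))
  rw [conjMeanInequality_iff] at *
  set φ := (QuotientGroup.mk' N).subgroupMap (P : Subgroup G) with hφ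
  have hsurj : Function.Surjective φ := MonoidHom.subgroupMap_surjective _ _
  have hcardP : Nat.card (P : Subgroup G) =
      Nat.card ((P : Subgroup G).map (QuotientGroup.mk' N)) * Nat.card φ.ker := by
    rw [← φ.ker.card_mul_index, Subgroup.index_ker, mul_comm, MonoidHom.range_eq_top.2 hsurj,
      Subgroup.card_top]
  have hprod : ∏ x : (P : Subgroup G), (conjInto ⊤ (P : Subgroup G) {(x : G)}).ncard =
      (∏ y : (P : Subgroup G).map (QuotientGroup.mk' N),
        (conjInto ⊤ ((P : Subgroup G).map (QuotientGroup.mk' N)) {(y : G ⧸ N)}).ncard) ^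
          Nat.card φ.ker * ∏ x : (P : Subgroup G), (conjInto N (P : Subgroup G) {(x : G)}).ncard := by
    -- The quotient factor depends only on the image of x, so each of its values occurs |ker φ|
    -- times.
    rw [← Fintype.prod_comp_hom_of_surjective φ hsurj, ← Finset.prod_mul_distrib]
    refine Finset.prod_congr rfl fun x _ => ?_
    rw [ncard_conjInto_top N P (by simp), Set.image_singleton]
    rfl
  have hcardG : Nat.card (⊤ : Subgroup G) = Nat.card (⊤ : Subgroup (G ⧸ N)) * Nat.card N := by
    rw [Subgroup.card_top, Subgroup.card_top]
    exact Subgroup.card_eq_card_quotient_mul_card_subgroup N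
  have hfix := ncard_conjInto_top N P (A := (P : Subgroup G)) subset_rfl
  rw [← Subgroup.coe_map] at hfix
  rw [hprod, hfix, hcardG]
  calc _ = ((∏ y : (P : Subgroup G).map (QuotientGroup.mk' N),
        (conjInto ⊤ ((P : Subgroup G).map (QuotientGroup.mk' N)) {(y : G ⧸ N)}).ncard) ^ p) ^
          Nat.card φ.ker *
          (∏ x : (P : Subgroup G), (conjInto N (P : Subgroup G) {(x : G)}).ncard) ^ p := by ring
    _ ≤ _ := Nat.mul_le_mul (Nat.pow_le_pow_left hQ _) hN
    _ = _ := by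
      rw [hcardP]
      ring

/-! ### From conjugators back to Sylow numbers -/

theorem conjInto_top_self [Finite G] {p : ℕ} (P : Sylow p G) :
    conjInto ⊤ (P : Subgroup G) ((P : Subgroup G) : Set G) = {n | n • P = P} := by
  ext n
  refine ⟨fun ⟨_, h⟩ => Sylow.ext (P.is_maximal' (n • P).isPGroup' fun a ha => ?_), fun h => ?_⟩
  · exact ⟨_, h a ha, by simp [mul_assoc]⟩
  · refine ⟨trivial, fun a ha => ?_⟩
    obtain ⟨x, hx, rfl⟩ : a ∈ ((n • P : Sylow p G) : Subgroup G) := by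
      rw [show n • P = P from h]; exact ha
    change n⁻¹ * (n * x * n⁻¹) * n ∈ (P : Subgroup G)
    rwa [show n⁻¹ * (n * x * n⁻¹) * n = x by group]

theorem ncard_conjInto_top_singleton [Finite G] {p : ℕ} [hp : Fact p.Prime] (P : Sylow p G)
    (x : G) : (conjInto ⊤ (P : Subgroup G) {x}).ncard =
      numSylowContaining p x * (conjInto ⊤ (P : Subgroup G) ((P : Subgroup G) : Set G)).ncard := by
  have hmem : ∀ g : G, x ∈ g • P ↔ g⁻¹ * x * g ∈ (P : Subgroup G) := by
    intro g
    refine ⟨fun h => ?_, fun h => ⟨_, h, by simp [mul_assoc]⟩⟩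
    obtain ⟨y, hy, rfl⟩ := h
    change g⁻¹ * (g * y * g⁻¹) * g ∈ (P : Subgroup G)
    rwa [show g⁻¹ * (g * y * g⁻¹) * g = y by group]
  have hfib := Set.ncard_eq_mul_of_fiber (fun g : G => g • P) (conjInto ⊤ (P : Subgroup G) {x})
    {Q : Sylow p G | x ∈ Q} (conjInto ⊤ (P : Subgroup G) ((P : Subgroup G) : Set G)).ncard ?_ ?_
  · exact hfib
  · rintro g ⟨-, hg⟩
    exact (hmem g).2 (hg x rfl)
  · intro Q hQ
    obtain ⟨g, rfl⟩ := MulAction.exists_smul_eq G P Q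
    symm
    rw [conjInto_top_self]
    refine Set.ncard_congr (fun k _ => g * k) ?_ ?_ ?_
    · intro k (hk : k • P = P)
      have h2 : (g * k) • P = g • P := by rw [mul_smul, hk]
      refine ⟨⟨trivial, ?_⟩, h2⟩
      rintro _ rfl
      rw [← hmem, h2]
      exact hQ
    · intro a b _ _ hab
      simpa using hab
    · rintro k ⟨-, hk⟩
      refine ⟨g⁻¹ * k, ?_, by group⟩
      change (g⁻¹ * k) • P = P
      have hk' : k • P = g • P := hk
      rw [mul_smul, hk', inv_smul_smul]

theorem Real.rpow_one_div_le_rpow_one_div_iff {L n b p : ℕ} (hb : b ≠ 0) (hp : p ≠ 0) :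
    (L : ℝ) ^ (1 / (b : ℝ)) ≤ (n : ℝ) ^ (1 / (p : ℝ)) ↔ L ^ p ≤ n ^ b := by
  have hb' : (b : ℝ) ≠ 0 := by exact_mod_cast hb
  have hp' : (p : ℝ) ≠ 0 := by exact_mod_cast hp
  have hpos : (0 : ℝ) < (b * p : ℝ) := by positivity
  rw [← Real.rpow_le_rpow_iff (by positivity) (by positivity) hpos, ← Real.rpow_mul (by positivity),
    ← Real.rpow_mul (by positivity), show 1 / (b : ℝ) * (b * p) = p by field_simp,
    show 1 / (p : ℝ) * (b * p) = b by field_simp, Real.rpow_natCast, Real.rpow_natCast]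
  exact_mod_cast Iff.rfl

theorem sylowMeanInequality_iff [Finite G] {p : ℕ} [hp : Fact p.Prime] :
    SylowMeanInequality p G ↔ ∀ P : Sylow p G, ConjMeanInequality p ⊤ (P : Subgroup G) := by
  refine forall_congr' fun P => ?_
  cases nonempty_fintype (P : Subgroup G)
  have hc := ncard_conjInto_top_singleton P
  have hG : Nat.card (⊤ : Subgroup G) =
      numSylow p G * (conjInto ⊤ (P : Subgroup G) ((P : Subgroup G) : Set G)).ncard := by
    have h1 := hc 1
    rw [conjInto_singleton_one] at h1
    have h2 : numSylowContaining p (1 : G) = numSylow p G :=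
      Nat.card_congr (Equiv.subtypeUnivEquiv fun Q => Q.one_mem)
    rw [← h2, ← h1]
    rfl
  set e := (conjInto ⊤ (P : Subgroup G) ((P : Subgroup G) : Set G)).ncard with he
  have he0 : 0 < e := (Set.ncard_pos (Set.toFinite _)).2
    ⟨1, trivial, fun a ha => by rw [inv_one, one_mul, mul_one]; exact ha⟩
  set b := Nat.card (P : Subgroup G) with hb
  have hb0 : b ≠ 0 := Nat.card_pos.ne'
  have hprod : ∏ x : (P : Subgroup G), (conjInto ⊤ (P : Subgroup G) {(x : G)}).ncard =
      (∏ x : (P : Subgroup G), numSylowContaining p (x : G)) * e ^ b := by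
    have : e ^ b = ∏ _x : (P : Subgroup G), e := by simp [hb, Nat.card_eq_fintype_card]
    rw [this, ← Finset.prod_mul_distrib]
    exact Finset.prod_congr rfl fun x _ => hc _
  have hlhs : (∏ᶠ x : (P : Subgroup G), (numSylowContaining p (x : G) : ℝ)) =
      ((∏ x : (P : Subgroup G), numSylowContaining p (x : G) : ℕ) : ℝ) := by
    rw [finprod_eq_prod_of_fintype]
    push_cast
    rfl
  rw [conjMeanInequality_iff, hprod, hG]
  change (∏ᶠ x : (P : Subgroup G), (numSylowContaining p (x : G) : ℝ)) ^ (1 / (b : ℝ)) ≤ _ ↔ _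
  rw [hlhs, Real.rpow_one_div_le_rpow_one_div_iff hb0 hp.out.ne_zero]
  obtain ⟨q, rfl⟩ : ∃ q, p = q + 1 := ⟨p - 1, by have := hp.out.pos; omega⟩
  simp only [Nat.add_sub_cancel]
  set L := ∏ x : (P : Subgroup G), numSylowContaining (q + 1) (x : G)
  have e1 : (L * e ^ b) ^ (q + 1) = L ^ (q + 1) * e ^ (b * (q + 1)) := by ring
  have e2 : (numSylow (q + 1) G * e) ^ b * e ^ (b * q) = numSylow (q + 1) G ^ b * e ^ (b * (q + 1)) := by
    ring
  rw [e1, e2]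
  exact (Nat.mul_le_mul_right_iff (by positivity)).symm

end conjInto

/-! ### Counting points fixed modulo a subgroup; the abelian case -/

/-- The mean inequality for a group `P` acting on a group `V` by `ρ`, counting elements that are
fixed modulo the subgroup `T`. -/
def TwistedMeanInequality (p : ℕ) {P V : Type*} [Group P] [Group V] (ρ : P →* MulAut V)
    (T : Subgroup V) : Prop :=
  (∏ᶠ x : P, {v : V | v⁻¹ * ρ x v ∈ T}.ncard) ^ p ≤
    Nat.card V ^ Nat.card P * {v : V | ∀ x, v⁻¹ * ρ x v ∈ T}.ncard ^ (Nat.card P * (p - 1))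

/-- For x in P, right multiplication by x⁻¹ turns n⁻¹xn ∈ P into n⁻¹(xnx⁻¹) ∈ P, a condition on the
action alone, modulo P ∩ N. -/
theorem conjMeanInequality_range_iff {G P : Type*} [Group G] [Group P] (p : ℕ) (ι : P →* G)
    (hι : Function.Injective ι) (N : Subgroup G) (ρ : P →* MulAut N)
    (hρ : ∀ x n, (ρ x n : G) = ι x * n * (ι x)⁻¹) :
    ConjMeanInequality p N ι.range ↔ TwistedMeanInequality p ρ (ι.range.subgroupOf N) := by
  have hmem : ∀ (x : P) (n : N), n⁻¹ * ρ x n ∈ ι.range.subgroupOf N ↔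
      (n : G)⁻¹ * ι x * n ∈ ι.range := by
    intro x n
    rw [Subgroup.mem_subgroupOf, Subgroup.coe_mul, hρ, Subgroup.coe_inv,
      ← Subgroup.mul_mem_cancel_right ι.range (y := (n : G)⁻¹ * ι x * n) (x := (ι x)⁻¹)
        (inv_mem ⟨x, rfl⟩)]
    simp only [mul_assoc]
  have h1 : ∀ x : P, {n : N | n⁻¹ * ρ x n ∈ ι.range.subgroupOf N}.ncard =
      (conjInto N ι.range {ι x}).ncard := by
    intro x
    refine Set.ncard_congr (fun n _ => (n : G)) ?_ ?_ ?_
    · rintro n hn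
      refine ⟨n.2, ?_⟩
      rintro _ rfl
      exact (hmem x n).1 hn
    · intro a b _ _ hab
      exact Subtype.ext hab
    · rintro n ⟨hn, hn'⟩
      exact ⟨⟨n, hn⟩, (hmem x ⟨n, hn⟩).2 (hn' _ rfl), rfl⟩
  have h2 : {n : N | ∀ x, n⁻¹ * ρ x n ∈ ι.range.subgroupOf N}.ncard =
      (conjInto N ι.range ι.range).ncard := by
    refine Set.ncard_congr (fun n _ => (n : G)) ?_ ?_ ?_
    · rintro n hn
      refine ⟨n.2, ?_⟩
      rintro _ ⟨x, rfl⟩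
      exact (hmem x n).1 (hn x)
    · intro a b _ _ hab
      exact Subtype.ext hab
    · rintro n ⟨hn, hn'⟩
      exact ⟨⟨n, hn⟩, fun x => (hmem x ⟨n, hn⟩).2 (hn' _ ⟨x, rfl⟩), rfl⟩
  have h3 : Nat.card ι.range = Nat.card P := Nat.card_congr (MonoidHom.ofInjective hι).symm.toEquiv
  have h4 : ∏ᶠ x : P, {n : N | n⁻¹ * ρ x n ∈ ι.range.subgroupOf N}.ncard =
      ∏ᶠ y : ι.range, (conjInto N ι.range {(y : G)}).ncard :=
    finprod_eq_of_bijective (MonoidHom.ofInjective hι) (MonoidHom.ofInjective hι).bijective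
      fun x => h1 x
  rw [ConjMeanInequality, TwistedMeanInequality, h2, h3, h4]

/-- The fixed subgroups are independent. In a relation ∏ u i = 1, applying `a j` and dividing by the
original relation removes the term u j, while commutation keeps the other terms fixed by their own
automorphisms; by induction they become trivial, so each u i is fixed by both `a i` and `a j`. -/
theorem MulAut.prod_card_fixed_le {V ι : Type*} [Group V] [Finite V] [Fintype ι]
    (hV : ∀ a b : V, a * b = b * a) (a : ι → MulAut V) (hcomm : ∀ i j, Commute (a i) (a j))
    (hdisj : ∀ i j, i ≠ j → ∀ v, a i v = v → a j v = v → v = 1) :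
    ∏ i, {v | a i v = v}.ncard ≤ Nat.card V := by
  classical
  let _ : CommGroup V := { ‹Group V› with mul_comm := hV }
  have indep : ∀ (s : Finset ι) (u : ι → V), (∀ i ∈ s, a i (u i) = u i) → ∏ i ∈ s, u i = 1 →
      ∀ i ∈ s, u i = 1 := by
    intro s
    induction s using Finset.induction_on with
    | empty => simp
    | insert j s hj ih =>
      intro u hu hprod
      have hs : ∀ i ∈ s, u i = 1 := by
        have h1 : ∏ i ∈ s, a j (u i) * (u i)⁻¹ = 1 := by
          have h2 : a j (∏ i ∈ insert j s, u i) * (∏ i ∈ insert j s, u i)⁻¹ = 1 := by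
            rw [hprod]; simp
          rw [map_prod, ← Finset.prod_inv_distrib, ← Finset.prod_mul_distrib,
            Finset.prod_insert hj, hu j (Finset.mem_insert_self _ _)] at h2
          simpa using h2
        intro i hi
        have hui := hu i (Finset.mem_insert_of_mem hi)
        have h3 := ih (fun i => a j (u i) * (u i)⁻¹) (fun i hi => ?_) h1 i hi
        · exact hdisj i j (by rintro rfl; exact hj hi) _ hui (mul_inv_eq_one.1 h3)
        · have hui := hu i (Finset.mem_insert_of_mem hi)
          have h4 : a i (a j (u i)) = a j (a i (u i)) := DFunLike.congr_fun (hcomm i j).eq (u i)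
          rw [map_mul, map_inv, h4, hui]
      intro i hi
      rcases Finset.mem_insert.1 hi with rfl | hi
      · rw [Finset.prod_insert hj, Finset.prod_eq_one hs, mul_one] at hprod
        exact hprod
      · exact hs i hi
  have hinj : Function.Injective
      (fun u : (i : ι) → {v : V // a i v = v} => ∏ i, (u i : V)) := by
    intro u w huw
    have h1 := indep Finset.univ (fun i => (u i : V) * (w i : V)⁻¹)
      (fun i _ => by rw [map_mul, map_inv, (u i).2, (w i).2])
      (by rw [Finset.prod_mul_distrib, Finset.prod_inv_distrib]; exact mul_inv_eq_one.2 huw)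
    funext i
    exact Subtype.ext (mul_inv_eq_one.1 (h1 i (Finset.mem_univ i)))
  have := Nat.card_le_card_of_injective _ hinj
  rw [Nat.card_pi] at this
  exact this

/-- The mean inequality for a `p`-group acting on a finite abelian group such that the elements
acting centrally act trivially or fixed-point-freely. -/
theorem TwistedMeanInequality.of_abelian {p : ℕ} [hp : Fact p.Prime] {P V : Type*} [Group P]
    [Group V] [Finite P] [Finite V] (hP : IsPGroup p P) (hV : ∀ a b : V, a * b = b * a)
    (ρ : P →* MulAut V)
    (h : ∀ z : P, (∀ x, Commute (ρ x) (ρ z)) → ρ z = 1 ∨ ∀ v, ρ z v = v → v = 1) :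
    TwistedMeanInequality p ρ ⊥ := by
  cases nonempty_fintype P
  have hp0 := hp.out.pos
  rw [TwistedMeanInequality, finprod_eq_prod_of_fintype]
  have hset : ∀ x : P, {v : V | v⁻¹ * ρ x v ∈ (⊥ : Subgroup V)} = {v | ρ x v = v} := by
    intro x
    ext v
    change v⁻¹ * ρ x v ∈ (⊥ : Subgroup V) ↔ ρ x v = v
    rw [Subgroup.mem_bot, inv_mul_eq_one, eq_comm]
  simp only [hset]
  by_cases htriv : ∀ x, ρ x = 1
  · have e1 : ∀ x : P, {v : V | ρ x v = v} = Set.univ := fun x => by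
      ext v; simp [htriv x]
    have e2 : {v : V | ∀ x, v⁻¹ * ρ x v ∈ (⊥ : Subgroup V)} = Set.univ := by
      ext v; simp [htriv]
    simp only [e1, e2, Set.ncard_univ, Finset.prod_const, Finset.card_univ,
      ← Nat.card_eq_fintype_card]
    rw [← pow_mul, ← pow_add]
    obtain ⟨q, rfl⟩ : ∃ q, p = q + 1 := ⟨p - 1, by omega⟩
    exact le_of_eq (by simp only [Nat.add_sub_cancel]; ring)
  · push Not at htriv
    obtain ⟨x₀, hx₀⟩ := htriv
    have hR : IsPGroup p ρ.range := hP.of_surjective ρ.rangeRestrict ρ.rangeRestrict_surjective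
    have : Nontrivial ρ.range := ⟨⟨⟨ρ x₀, x₀, rfl⟩, 1, fun h => hx₀ (congrArg Subtype.val h)⟩⟩
    have := hR.center_nontrivial
    obtain ⟨⟨⟨_, z, rfl⟩, hzc⟩, hz1⟩ := exists_ne (1 : Subgroup.center ρ.range)
    have hz1 : ρ z ≠ 1 := fun h => hz1 (Subtype.ext (Subtype.ext h))
    have hzc : ∀ x, Commute (ρ x) (ρ z) := fun x =>
      congrArg Subtype.val (Subgroup.mem_center_iff.1 hzc ⟨ρ x, x, rfl⟩)
    have hfree := (h z hzc).resolve_left hz1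
    have hdiff : ∀ i j : ℕ, i < j → j < p → ∀ (x : P) (v : V), ρ (x * z ^ i) v = v →
        ρ (x * z ^ j) v = v → v = 1 := by
      intro i j hij hj x v hi hj'
      apply hfree
      -- As 0 < j - i < p and z has p-power order, z is a power of z^(j-i), so a point fixed by the
      -- latter is fixed by z.
      have hd : (j - i).Coprime (orderOf z) := by
        obtain ⟨k, hk⟩ := (IsPGroup.iff_orderOf.1 hP) z
        rw [hk]
        exact Nat.Coprime.pow_right k (Nat.Coprime.symm
          ((Nat.Prime.coprime_iff_not_dvd hp.out).2 fun hdvd => by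
            have := Nat.le_of_dvd (by omega) hdvd
            omega))
      have h1 : ρ (z ^ (j - i)) v = v := by
        have h2 : ρ (x * z ^ i) (ρ (z ^ (j - i)) v) = ρ (x * z ^ i) v := by
          rw [hi, ← MulAut.mul_apply, ← map_mul, mul_assoc, ← pow_add, Nat.add_sub_cancel' hij.le,
            hj']
        exact (ρ (x * z ^ i)).injective h2
      obtain ⟨m, hm⟩ := exists_pow_eq_self_of_coprime hd
      rw [← hm]
      have : ∀ m : ℕ, ρ ((z ^ (j - i)) ^ m) v = v := by
        intro m
        induction m with
        | zero => simp
        | succ m ih => rw [pow_succ, map_mul, MulAut.mul_apply, h1, ih]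
      exact this m
    have hle : ∀ x : P, ∏ i : Fin p, {v : V | ρ (x * z ^ (i : ℕ)) v = v}.ncard ≤ Nat.card V := by
      intro x
      refine MulAut.prod_card_fixed_le hV (fun i : Fin p => ρ (x * z ^ (i : ℕ))) ?_ ?_
      · intro i j
        simp only [map_mul, map_pow]
        have hx : ∀ k, Commute (ρ x) (ρ z ^ k) := fun k => (hzc x).pow_right k
        exact ((Commute.refl _).mul_right (hx _)).mul_left
          (((hx _).symm).mul_right (Commute.pow_pow_self _ _ _))
      · intro i j hij v hi hj
        rcases lt_or_gt_of_ne (fun h => hij (Fin.ext h)) with hlt | hlt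
        · exact hdiff i j hlt j.2 x v hi hj
        · exact hdiff j i hlt i.2 x v hj hi
    have h1 : 1 ≤ {v : V | ∀ x, v⁻¹ * ρ x v ∈ (⊥ : Subgroup V)}.ncard :=
      (Set.ncard_pos (Set.toFinite _)).2 ⟨1, fun x => by simp⟩
    -- Each of the p factors is reindexed by its own translation x ↦ xz^i.
    calc (∏ x : P, {v : V | ρ x v = v}.ncard) ^ p
        = ∏ i : Fin p, ∏ x : P, {v : V | ρ (x * z ^ (i : ℕ)) v = v}.ncard := by
          have : ∀ i : Fin p, ∏ x : P, {v : V | ρ (x * z ^ (i : ℕ)) v = v}.ncard =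
              ∏ x : P, {v : V | ρ x v = v}.ncard := fun i =>
            Equiv.prod_comp (Equiv.mulRight (z ^ (i : ℕ))) fun x => {v : V | ρ x v = v}.ncard
          simp only [this, Finset.prod_const, Finset.card_univ, Fintype.card_fin]
      _ = ∏ x : P, ∏ i : Fin p, {v : V | ρ (x * z ^ (i : ℕ)) v = v}.ncard := Finset.prod_comm
      _ ≤ ∏ _x : P, Nat.card V := Finset.prod_le_prod' fun x _ => hle x
      _ = Nat.card V ^ Nat.card P := by simp
      _ ≤ _ := Nat.le_mul_of_pos_right _ (Nat.pow_pos h1)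

/-! ### Normal subgroups of index p and coinduced actions -/

theorem Subgroup.exists_mul_pow_of_index_prime {P : Type*} [Group P] {p : ℕ} (hp : p.Prime)
    {M : Subgroup P} [M.Normal] (hM : M.index = p) {x : P} (hx : x ∉ M) (g : P) :
    ∃ (m : M) (j : Fin p), g = m * x ^ (j : ℕ) := by
  have := Fact.mk hp
  have hcard : Nat.card (P ⧸ M) = p := hM
  have hx1 : (QuotientGroup.mk x : P ⧸ M) ≠ 1 := by
    rwa [Ne, QuotientGroup.eq_one_iff]
  obtain ⟨j, hj⟩ := mem_powers_of_prime_card (g' := (QuotientGroup.mk g : P ⧸ M)) hcard hx1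
  have hj' : (QuotientGroup.mk x : P ⧸ M) ^ (j % p) = QuotientGroup.mk g := by
    rw [← hcard, pow_mod_natCard]; exact hj
  refine ⟨⟨g * (x ^ (j % p))⁻¹, ?_⟩, ⟨j % p, Nat.mod_lt _ hp.pos⟩, by simp⟩
  rw [← QuotientGroup.eq_one_iff, QuotientGroup.mk_mul, QuotientGroup.mk_inv, QuotientGroup.mk_pow,
    hj', mul_inv_cancel]

/-- The mean inequality for a coinduced action: `V` is the group of `p`-tuples over `W` formed by
the values of `π` along the transversal `y ^ i` of the subgroup `M` of index `p`. -/
theorem TwistedMeanInequality.of_coinduced {P V W : Type*} [Group P] [Group V] [Group W]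
    [Finite P] [Finite V] [Finite W] {p : ℕ} (hp : p.Prime) {M : Subgroup P} [M.Normal]
    (hM : M.index = p) {y : P} (hy : y ∉ M) {ρ : P →* MulAut V} {σ : M →* MulAut W}
    {T : Subgroup V} {T₁ : Subgroup W} (hT₁ : ∀ m, ∀ w ∈ T₁, σ m w ∈ T₁) (π : V →* W)
    (hπ : ∀ (m : M) v, π (ρ m v) = σ m (π v))
    (hbij : Function.Bijective fun (v : V) (i : Fin p) => π (ρ (y ^ (i : ℕ)) v))
    (hT : ∀ v, v ∈ T ↔ ∀ i : Fin p, π (ρ (y ^ (i : ℕ)) v) ∈ T₁)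
    (H : TwistedMeanInequality p σ T₁) : TwistedMeanInequality p ρ T := by
  classical
  cases nonempty_fintype P
  have hadd : ∀ (a b : P) (v : V), ρ (a * b) v = ρ a (ρ b v) := fun a b v => by
    rw [map_mul, MulAut.mul_apply]
  have hTπ : ∀ (g : P) (v : V), v ∈ T → π (ρ g v) ∈ T₁ := by
    intro g v hv
    obtain ⟨m, j, rfl⟩ := Subgroup.exists_mul_pow_of_index_prime hp hM hy g
    rw [hadd, hπ]
    exact hT₁ _ _ ((hT v).1 hv j)
  have hTinv : ∀ (g : P) (v : V), v ∈ T → ρ g v ∈ T := by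
    intro g v hv
    rw [hT]
    intro i
    rw [← hadd]
    exact hTπ _ _ hv
  have hcoset : ∀ {v : V} {a b : P}, v⁻¹ * ρ a v ∈ T → v⁻¹ * ρ b v ∈ T →
      v⁻¹ * ρ (a * b) v ∈ T := by
    intro v a b ha hb
    have := T.mul_mem ha (hTinv a _ hb)
    rw [map_mul, map_inv, ← hadd] at this
    simpa [mul_assoc] using this
  set f : P → ℕ := fun x => {v : V | v⁻¹ * ρ x v ∈ T}.ncard with hf
  set f₁ : M → ℕ := fun m => {w : W | w⁻¹ * σ m w ∈ T₁}.ncard with hf₁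
  set E := {v : V | ∀ x, v⁻¹ * ρ x v ∈ T} with hE
  set E₁ := {w : W | ∀ m, w⁻¹ * σ m w ∈ T₁} with hE₁
  -- Elements of `M` act on each coordinate.
  have hin : ∀ m : M, f m = ∏ i : Fin p, f₁ (MulAut.conjNormal (y ^ (i : ℕ)) m) := by
    intro m
    have hpi : f m = (Set.pi Set.univ fun i : Fin p =>
        {w : W | w⁻¹ * σ (MulAut.conjNormal (y ^ (i : ℕ)) m) w ∈ T₁}).ncard := by
      have hmem : ∀ v : V, v⁻¹ * ρ m v ∈ T ↔ ∀ i : Fin p, (π (ρ (y ^ (i : ℕ)) v))⁻¹ *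
          σ (MulAut.conjNormal (y ^ (i : ℕ)) m) (π (ρ (y ^ (i : ℕ)) v)) ∈ T₁ := by
        intro v
        rw [hT]
        refine forall_congr' fun i => ?_
        have e : ((MulAut.conjNormal (y ^ (i : ℕ)) m : M) : P) * y ^ (i : ℕ) = y ^ (i : ℕ) * m := by
          rw [MulAut.conjNormal_apply, inv_mul_cancel_right]
        rw [map_mul, map_mul, map_inv, map_inv, ← hπ, ← hadd, ← hadd, e]
      refine Set.ncard_congr (fun v _ i => π (ρ (y ^ (i : ℕ)) v)) ?_ ?_ ?_
      · intro v hv i _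
        exact (hmem v).1 hv i
      · intro v w _ _ hvw
        exact hbij.1 hvw
      · intro w hw
        obtain ⟨v, rfl⟩ := hbij.2 w
        exact ⟨v, (hmem v).2 fun i => hw i trivial, rfl⟩
    rw [hpi, ← Nat.card_coe_set_eq, Nat.card_congr (Equiv.Set.univPi _), Nat.card_pi]
    rfl
  have hprodM : ∏ m : M, f m = (∏ m : M, f₁ m) ^ p := by
    simp only [hin]
    rw [Finset.prod_comm]
    have : ∀ i : Fin p, ∏ m : M, f₁ (MulAut.conjNormal (y ^ (i : ℕ)) m) = ∏ m : M, f₁ m :=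
      fun i => Equiv.prod_comp (MulAut.conjNormal (y ^ (i : ℕ)) : MulAut M).toEquiv f₁
    simp only [this, Finset.prod_const, Finset.card_univ, Fintype.card_fin]
  -- Elements outside `M` permute the coordinates cyclically.
  have hout : ∀ x : P, x ∉ M → f x * Nat.card T₁ ≤ Nat.card W * Nat.card T := by
    intro x hx
    have hpow : ∀ (v : V) (j : ℕ), v⁻¹ * ρ x v ∈ T → v⁻¹ * ρ (x ^ j) v ∈ T := by
      intro v j hv
      induction j with
      | zero => simp
      | succ j ih => rw [pow_succ]; exact hcoset ih hv
    -- The powers of x also represent all cosets of M, so a tuple fixed by x modulo T is determined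
    -- modulo T by its coordinate π v modulo T₁.
    have hdet : ∀ v v' : V, v⁻¹ * ρ x v ∈ T → v'⁻¹ * ρ x v' ∈ T → (π v)⁻¹ * π v' ∈ T₁ →
        v⁻¹ * v' ∈ T := by
      intro v v' hv hv' hvv'
      rw [hT]
      intro i
      obtain ⟨m, j, hj⟩ := Subgroup.exists_mul_pow_of_index_prime hp hM hx (y ^ (i : ℕ))
      rw [hj, hadd, hπ]
      apply hT₁
      have h1 := hTπ 1 _ (hpow v j hv)
      have h2 := hTπ 1 _ (hpow v' j hv')
      rw [map_one, MulAut.one_apply, map_mul, map_inv] at h1 h2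
      have := T₁.mul_mem (T₁.mul_mem (T₁.inv_mem h1) hvv') h2
      rw [map_mul, map_mul, map_inv, map_inv]
      simpa [mul_assoc] using this
    -- A reference tuple r(w) is chosen for each coordinate w. Then (v, t) ↦ (π v · t, r⁻¹v) is
    -- injective into W × T, since the first entry determines r.
    choose r hr using fun w : {w : W // ∃ v : V, v⁻¹ * ρ x v ∈ T ∧ (π v)⁻¹ * w ∈ T₁} => w.2
    have hw : ∀ u : {v : V | v⁻¹ * ρ x v ∈ T} × T₁,
        ∃ v : V, v⁻¹ * ρ x v ∈ T ∧ (π v)⁻¹ * (π u.1 * u.2) ∈ T₁ :=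
      fun u => ⟨u.1, u.1.2, by simp⟩
    have hmemT : ∀ u : {v : V | v⁻¹ * ρ x v ∈ T} × T₁, (r ⟨_, hw u⟩)⁻¹ * (u.1 : V) ∈ T := by
      intro u
      refine hdet _ _ (hr ⟨_, hw u⟩).1 u.1.2 ?_
      have := T₁.mul_mem (hr ⟨_, hw u⟩).2 (T₁.inv_mem u.2.2)
      simpa [mul_assoc] using this
    have hinj : Function.Injective (fun u : {v : V | v⁻¹ * ρ x v ∈ T} × T₁ =>
        ((π u.1 * u.2 : W), (⟨(r ⟨_, hw u⟩)⁻¹ * (u.1 : V), hmemT u⟩ : T))) := by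
      rintro ⟨v, t⟩ ⟨v', t'⟩ h
      simp only [Prod.mk.injEq, Subtype.mk.injEq] at h
      obtain ⟨h1, h2⟩ := h
      have h3 : (⟨_, hw (v, t)⟩ : {w : W // ∃ v : V, v⁻¹ * ρ x v ∈ T ∧ (π v)⁻¹ * w ∈ T₁}) =
        ⟨_, hw (v', t')⟩ := Subtype.ext h1
      rw [h3] at h2
      have h4 : v = v' := Subtype.ext (mul_left_cancel h2)
      subst h4
      exact Prod.ext rfl (Subtype.ext (mul_left_cancel h1))
    have := Nat.card_le_card_of_injective _ hinj
    rwa [Nat.card_prod, Nat.card_prod] at this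
  -- Elements fixed by `M` modulo `T₁` give constant tuples fixed by `P` modulo `T`.
  have hfix : E₁.ncard * Nat.card T ≤ E.ncard * Nat.card T₁ := by
    choose s hs using fun w : W => hbij.2 fun _ => w
    have hs' : ∀ (w : W) (i : Fin p), π (ρ (y ^ (i : ℕ)) (s w)) = w := fun w i =>
      congrFun (hs w) i
    have hgen : ∀ w ∈ E₁, ∀ g : P, w⁻¹ * π (ρ g (s w)) ∈ T₁ := by
      intro w hw g
      obtain ⟨m, j, rfl⟩ := Subgroup.exists_mul_pow_of_index_prime hp hM hy g
      rw [hadd, hπ, hs']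
      exact hw m
    have hsE : ∀ w ∈ E₁, s w ∈ E := by
      intro w hw x
      rw [hT]
      intro i
      rw [map_mul, map_mul, map_inv, map_inv, hs', ← hadd]
      exact hgen w hw _
    have hstE : ∀ w ∈ E₁, ∀ t ∈ T, s w * t ∈ E := by
      intro w hw t ht x
      have := T.mul_mem (T.mul_mem (T.inv_mem ht) (hsE w hw x)) (hTinv x t ht)
      simpa [mul_assoc] using this
    have hπs : ∀ w, π (s w) = w := fun w => by simpa using hs' w ⟨0, hp.pos⟩
    have hπT : ∀ t ∈ T, π t ∈ T₁ := fun t ht => by simpa using hTπ 1 t ht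
    have hinj : Function.Injective (fun u : E₁ × T =>
        ((⟨s u.1 * u.2, hstE _ u.1.2 _ u.2.2⟩ : E), (⟨π u.2, hπT _ u.2.2⟩ : T₁))) := by
      rintro ⟨w, t⟩ ⟨w', t'⟩ h
      simp only [Prod.mk.injEq, Subtype.mk.injEq] at h
      obtain ⟨h1, h2⟩ := h
      have h3 := congrArg π h1
      rw [map_mul, map_mul, hπs, hπs, h2] at h3
      have h4 : w = w' := Subtype.ext (mul_right_cancel h3)
      subst h4
      exact Prod.ext rfl (Subtype.ext (mul_left_cancel h1))
    have := Nat.card_le_card_of_injective _ hinj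
    rwa [Nat.card_prod, Nat.card_prod] at this
  have hcardV : Nat.card V = Nat.card W ^ p := by
    rw [Nat.card_congr (Equiv.ofBijective _ hbij), Nat.card_pi]
    simp
  have hcardP : Nat.card P = p * Nat.card M := by
    rw [← M.card_mul_index, hM, mul_comm]
  have hcompl : Fintype.card {x : P // x ∉ M} = (p - 1) * Nat.card M := by
    rw [Fintype.card_subtype_compl, ← Nat.card_eq_fintype_card, hcardP, Nat.sub_mul, one_mul,
      Nat.card_eq_fintype_card]
  have hprodout : (∏ x : {x : P // x ∉ M}, f x) * Nat.card T₁ ^ ((p - 1) * Nat.card M) ≤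
      (Nat.card W * Nat.card T) ^ ((p - 1) * Nat.card M) := by
    rw [← hcompl, ← Finset.card_univ, ← Finset.prod_const, ← Finset.prod_const,
      ← Finset.prod_mul_distrib]
    exact Finset.prod_le_prod' fun x _ => hout x x.2
  have hsplit : ∏ x : P, f x = (∏ m : M, f m) * ∏ x : {x : P // x ∉ M}, f x :=
    (Fintype.prod_subtype_mul_prod_subtype (fun x => x ∈ M) f).symm
  rw [TwistedMeanInequality, finprod_eq_prod_of_fintype] at H ⊢
  change (∏ m, f₁ m) ^ p ≤ Nat.card W ^ Nat.card M * E₁.ncard ^ _ at H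
  change (∏ x, f x) ^ p ≤ _ * E.ncard ^ _
  rw [hcardV, hcardP, hsplit, hprodM]
  have ht : 0 < Nat.card T₁ := Nat.card_pos
  generalize Nat.card T₁ = t at *
  generalize Nat.card T = τ at *
  generalize Nat.card W = a at *
  generalize E.ncard = e at *
  generalize E₁.ncard = e₁ at *
  generalize Nat.card M = k at *
  generalize ∏ m, f₁ m = A at *
  generalize ∏ x : {x : P // x ∉ M}, f x = B at *
  obtain ⟨q, rfl⟩ : ∃ q, p = q + 1 := ⟨p - 1, by have := hp.pos; omega⟩
  simp only [Nat.add_sub_cancel] at *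
  -- This power of |T₁| makes both `hprodout` and `hfix` applicable without division; the powers of
  -- |T| introduced by the former are absorbed by the latter.
  refine Nat.le_of_mul_le_mul_right (c := (t ^ (q * k)) ^ (q + 1)) ?_ (by positivity)
  calc (A ^ (q + 1) * B) ^ (q + 1) * (t ^ (q * k)) ^ (q + 1)
      = (A ^ (q + 1)) ^ (q + 1) * (B * t ^ (q * k)) ^ (q + 1) := by ring
    _ ≤ (a ^ k * e₁ ^ (k * q)) ^ (q + 1) * ((a * τ) ^ (q * k)) ^ (q + 1) :=
      Nat.mul_le_mul (Nat.pow_le_pow_left H _) (Nat.pow_le_pow_left hprodout _)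
    _ = a ^ (k * (q + 1) * (q + 1)) * (e₁ * τ) ^ (q * k * (q + 1)) := by ring
    _ ≤ a ^ (k * (q + 1) * (q + 1)) * (e * t) ^ (q * k * (q + 1)) :=
      Nat.mul_le_mul_left _ (Nat.pow_le_pow_left hfix _)
    _ = _ := by ring

theorem IsPGroup.exists_normal_index_eq_of_ne_top {P : Type*} [Group P] [Finite P] {p : ℕ}
    [hp : Fact p.Prime] (hP : IsPGroup p P) {H : Subgroup P} (hH : H ≠ ⊤) :
    ∃ M : Subgroup P, H ≤ M ∧ M.Normal ∧ M.index = p := by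
  obtain ⟨k, hk⟩ := IsPGroup.iff_card.1 hP
  obtain ⟨l, hl⟩ := IsPGroup.iff_card.1 (hP.to_subgroup H)
  have hlk : l < k := by
    have h1 : Nat.card H ≤ Nat.card P := Subgroup.card_le_card_group H
    have h2 : Nat.card H ≠ Nat.card P := fun h => hH (Subgroup.card_eq_iff_eq_top H |>.1 h)
    have h3 : p ^ l < p ^ k := by rw [← hk, ← hl]; exact lt_of_le_of_ne h1 h2
    exact (Nat.pow_lt_pow_iff_right hp.out.one_lt).1 h3
  obtain ⟨M, hM, hHM⟩ := Sylow.exists_subgroup_card_pow_prime_le p (m := k - 1)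
    (hk ▸ pow_dvd_pow p (Nat.sub_le k 1)) H hl (by omega)
  have hidx : M.index = p := by
    have h1 := M.card_mul_index
    rw [hM, hk] at h1
    obtain ⟨j, rfl⟩ : ∃ j, k = j + 1 := ⟨k - 1, by omega⟩
    rw [Nat.add_sub_cancel, pow_succ] at h1
    exact Nat.eq_of_mul_eq_mul_left (Nat.pow_pos hp.out.pos) h1
  -- The index p is the smallest prime factor of |P|, which forces normality.
  refine ⟨M, hHM, Subgroup.normal_of_index_eq_minFac_card ?_, hidx⟩
  rw [hidx, hk, hp.out.pow_minFac (by omega)]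

theorem Subgroup.pow_mul_inv_pow_notMem {P : Type*} [Group P] {p : ℕ} (hp : p.Prime)
    {M : Subgroup P} [M.Normal] (hM : M.index = p) {y : P} (hy : y ∉ M) {i j : Fin p}
    (hij : i ≠ j) : y ^ (j : ℕ) * (y ^ (i : ℕ))⁻¹ ∉ M := by
  have := Fact.mk hp
  intro h
  have hcard : Nat.card (P ⧸ M) = p := hM
  have hy1 : (QuotientGroup.mk y : P ⧸ M) ≠ 1 := by rwa [Ne, QuotientGroup.eq_one_iff]
  have hord : orderOf (QuotientGroup.mk y : P ⧸ M) = p :=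
    orderOf_eq_prime (by rw [← hcard]; exact pow_card_eq_one') hy1
  rw [← QuotientGroup.eq_one_iff, QuotientGroup.mk_mul, QuotientGroup.mk_inv, QuotientGroup.mk_pow,
    QuotientGroup.mk_pow, mul_inv_eq_one] at h
  exact hij (Fin.ext (pow_injOn_Iio_orderOf (by simp [hord]) (by simp [hord]) h.symm))

/-! ### Direct factors permuted by a Sylow subgroup -/

section

variable {G : Type*} [Group G]

/-- Both steps, from G to N and from N to N₁, use that [K : Q ∩ K] = [QK : Q] when Q normalizes K,
and that the latter divides the index of Q in any larger group. -/
theorem Sylow.not_dvd_relIndex_of_subnormal [Finite G] {p : ℕ} [Fact p.Prime] (P : Sylow p G)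
    {N N₁ : Subgroup G} [N.Normal] (hle : N₁ ≤ N) (hN : N ≤ Subgroup.normalizer (N₁ : Set G)) :
    ¬ p ∣ (P : Subgroup G).relIndex N₁ := by
  intro hdvd
  refine P.not_dvd_index (hdvd.trans ?_)
  have h1 : (P : Subgroup G).relIndex N ∣ (P : Subgroup G).index := by
    rw [← Subgroup.relIndex_sup_of_le_normalizer Subgroup.le_normalizer_of_normal]
    exact Subgroup.relIndex_dvd_index_of_le le_sup_left
  have h2 : ((P : Subgroup G) ⊓ N).relIndex N₁ ∣ ((P : Subgroup G) ⊓ N).relIndex N := by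
    rw [← Subgroup.relIndex_sup_of_le_normalizer (inf_le_right.trans hN),
      ← Subgroup.relIndex_mul_relIndex _ ((P : Subgroup G) ⊓ N ⊔ N₁) N le_sup_left
        (sup_le inf_le_right hle)]
    exact dvd_mul_right _ _
  have h3 : ((P : Subgroup G) ⊓ N).relIndex N₁ = (P : Subgroup G).relIndex N₁ := by
    rw [← Subgroup.inf_relIndex_right, inf_assoc, inf_eq_right.2 hle, Subgroup.inf_relIndex_right]
  rw [Subgroup.inf_relIndex_right] at h2
  rw [← h3]
  exact h2.trans h1

theorem Subgroup.exists_projection {N N₁ N' : Subgroup G} (hsup : N₁ ⊔ N' = N)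
    (hinf : N₁ ⊓ N' = ⊥) (hcomm : ∀ a ∈ N₁, ∀ b ∈ N', a * b = b * a) :
    ∃ π : N →* N₁, ∀ (n : N) (a : N₁) (b : N'), (n : G) = a * b → π n = a := by
  have hc : ∀ (a : N₁) (b : N'), Commute (N₁.subtype a) (N'.subtype b) :=
    fun a b => hcomm a a.2 b b.2
  set φ := MonoidHom.noncommCoprod N₁.subtype N'.subtype hc with hφ
  have hinj : Function.Injective φ := by
    rw [hφ, MonoidHom.noncommCoprod_injective]
    refine ⟨N₁.subtype_injective, N'.subtype_injective, ?_⟩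
    rw [Subgroup.range_subtype, Subgroup.range_subtype, disjoint_iff, hinf]
  have hrange : φ.range = N := by
    rw [hφ, MonoidHom.noncommCoprod_range, Subgroup.range_subtype, Subgroup.range_subtype, hsup]
  let e : N₁ × N' ≃* φ.range := MonoidHom.ofInjective hinj
  refine ⟨((MonoidHom.fst N₁ N').comp e.symm.toMonoidHom).comp (Subgroup.inclusion hrange.ge), ?_⟩
  intro n a b hn
  have h1 : Subgroup.inclusion hrange.ge n = e (a, b) := Subtype.ext hn
  change (e.symm (Subgroup.inclusion hrange.ge n)).1 = a
  rw [h1, e.symm_apply_apply]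

/-- The maps n ↦ π(yⁱ n y⁻ⁱ) identify N with N₁^p. Injectivity comes from `hgen`: an element all of
whose P-conjugates lie in N' centralizes every conjugate of N₁. -/
theorem ConjMeanInequality.of_directFactor [Finite G] {p : ℕ} [hp : Fact p.Prime]
    {N N₁ N' : Subgroup G} [N.Normal] (P : Sylow p G) {M : Subgroup (P : Subgroup G)} [M.Normal]
    (hM : M.index = p) (hsup : N₁ ⊔ N' = N) (hinf : N₁ ⊓ N' = ⊥)
    (hcomm : ∀ a ∈ N₁, ∀ b ∈ N', a * b = b * a)
    (hMN₁ : ∀ m ∈ M, ∀ a ∈ N₁, (m : G) * a * (m : G)⁻¹ ∈ N₁)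
    (hMN' : ∀ m ∈ M, ∀ a ∈ N', (m : G) * a * (m : G)⁻¹ ∈ N')
    (hout : ∀ g : (P : Subgroup G), g ∉ M → ∀ a ∈ N₁, (g : G) * a * (g : G)⁻¹ ∈ N')
    (hgen : ∀ z ∈ N, (∀ g : (P : Subgroup G), ∀ a ∈ N₁, Commute z ((g : G) * a * (g : G)⁻¹)) →
      z = 1)
    (H : ConjMeanInequality p N₁ (M.map (P : Subgroup G).subtype)) :
    ConjMeanInequality p N (P : Subgroup G) := by
  classical
  have hN₁ : N₁ ≤ N := hsup ▸ le_sup_left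
  have hN' : N' ≤ N := hsup ▸ le_sup_right
  have hdec : ∀ n : N, ∃ (a : N₁) (b : N'), (n : G) = a * b := by
    intro n
    have hn : (n : G) ∈ N₁ ⊔ N' := hsup ▸ n.2
    rw [← SetLike.mem_coe, Subgroup.coe_mul_of_left_le_normalizer_right] at hn
    · obtain ⟨a, ha, b, hb, h⟩ := hn
      exact ⟨⟨a, ha⟩, ⟨b, hb⟩, h.symm⟩
    · rw [Subgroup.le_normalizer_iff]
      intro a ha b hb
      rwa [hcomm a ha b hb, mul_inv_cancel_right]
  obtain ⟨π, hπ⟩ := Subgroup.exists_projection hsup hinf hcomm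
  have hπ₁ : ∀ n : N, (h : (n : G) ∈ N₁) → π n = ⟨n, h⟩ := fun n h =>
    hπ n ⟨n, h⟩ 1 (by simp)
  have hπ' : ∀ n : N, (n : G) ∈ N' → π n = 1 := fun n h => hπ n 1 ⟨n, h⟩ (by simp)
  have hker : ∀ n : N, π n = 1 → (n : G) ∈ N' := by
    intro n hn
    obtain ⟨a, b, hab⟩ := hdec n
    rw [hπ n a b hab] at hn
    subst hn
    rw [hab]
    simp
  -- The actions by conjugation.
  set ρ : (P : Subgroup G) →* MulAut N := MulAut.conjNormal.comp (P : Subgroup G).subtype with hρ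
  have hρ_coe : ∀ (x : (P : Subgroup G)) (n : N), (ρ x n : G) = x * n * (x : G)⁻¹ :=
    fun x n => MulAut.conjNormal_apply _ _
  set ι₁ : M →* G := (P : Subgroup G).subtype.comp M.subtype with hι₁
  have hι₁_range : ι₁.range = M.map (P : Subgroup G).subtype := by
    rw [hι₁, MonoidHom.range_comp, Subgroup.range_subtype]
  have hnorm : ∀ m : M, ι₁ m ∈ Subgroup.normalizer (N₁ : Set G) := by
    have : ι₁.range ≤ Subgroup.normalizer (N₁ : Set G) := by
      rw [Subgroup.le_normalizer_iff]
      rintro _ ⟨m, rfl⟩ a ha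
      exact hMN₁ m m.2 a ha
    exact fun m => this ⟨m, rfl⟩
  set σ : M →* MulAut N₁ := N₁.normalizerMonoidHom.comp (ι₁.codRestrict _ hnorm) with hσ
  have hσ_coe : ∀ (m : M) (n : N₁), (σ m n : G) = ι₁ m * n * (ι₁ m)⁻¹ := fun m n => rfl
  -- An element of P ∩ N₁ outside M would, conjugating itself, lie in N₁ ∩ N' = 1.
  have hPN₁ : ∀ a ∈ N₁, a ∈ (P : Subgroup G) → a ∈ ι₁.range := by
    intro a ha haP
    by_cases haM : (⟨a, haP⟩ : (P : Subgroup G)) ∈ M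
    · exact ⟨⟨_, haM⟩, rfl⟩
    · have h1 := hout _ haM a ha
      simp only [mul_inv_cancel_right] at h1
      have h2 : a ∈ N₁ ⊓ N' := ⟨ha, h1⟩
      rw [hinf, Subgroup.mem_bot] at h2
      subst h2
      exact one_mem _
  have hπ_equiv : ∀ (m : M) (v : N), π (ρ m v) = σ m (π v) := by
    intro m v
    obtain ⟨a, b, hab⟩ := hdec v
    rw [hπ v a b hab]
    refine hπ _ _ ⟨(m : (P : Subgroup G)) * b * ((m : (P : Subgroup G)) : G)⁻¹, hMN' m m.2 b b.2⟩ ?_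
    rw [hρ_coe, hσ_coe, hab]
    change _ = ((m : (P : Subgroup G)) : G) * a * ((m : (P : Subgroup G)) : G)⁻¹ * _
    simp [mul_assoc]
  obtain ⟨y, hy⟩ : ∃ y, y ∉ M := by
    by_contra! h
    have : M = ⊤ := by ext; simp [h]
    rw [this, Subgroup.index_top] at hM
    exact hp.out.one_lt.ne hM
  have hadd : ∀ (a b : (P : Subgroup G)) (v : N), ρ (a * b) v = ρ a (ρ b v) := fun a b v => by
    rw [map_mul, MulAut.mul_apply]
  set Φ : N →* (Fin p → N₁) := MonoidHom.pi fun i => π.comp (ρ (y ^ (i : ℕ))).toMonoidHom with hΦ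
  have hΦ_apply : ∀ v i, Φ v i = π (ρ (y ^ (i : ℕ)) v) := fun v i => rfl
  have hΦ_inj : Function.Injective Φ := by
    rw [injective_iff_map_eq_one]
    intro z hz
    have h1 : ∀ g : (P : Subgroup G), (ρ g z : G) ∈ N' := by
      intro g
      obtain ⟨m, j, rfl⟩ := Subgroup.exists_mul_pow_of_index_prime hp.out hM hy g
      apply hker
      rw [hadd, hπ_equiv, ← hΦ_apply, hz]
      simp
    refine Subtype.ext (hgen z z.2 fun g a ha => ?_)
    have h2 := hcomm a ha _ (h1 g⁻¹)
    rw [hρ_coe] at h2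
    have h3 := congrArg (fun u => (g : G) * u * (g : G)⁻¹) h2
    rw [Commute, SemiconjBy]
    simpa [mul_assoc] using h3.symm
  -- For j ≠ i the element y^j y^(-i) lies outside M, so it moves N₁ into N', which π kills.
  have hΦ_single : ∀ (i : Fin p) (a : N₁),
      Φ (ρ (y ^ (i : ℕ))⁻¹ ⟨a, hN₁ a.2⟩) = Pi.mulSingle i a := by
    intro i a
    funext j
    rw [hΦ_apply, ← hadd]
    by_cases hij : i = j
    · subst hij
      rw [mul_inv_cancel, map_one, MulAut.one_apply, Pi.mulSingle_eq_same]
      exact hπ₁ _ a.2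
    · rw [Pi.mulSingle_eq_of_ne (Ne.symm hij)]
      apply hπ'
      rw [hρ_coe]
      exact hout _ (Subgroup.pow_mul_inv_pow_notMem hp.out hM hy hij) a a.2
  have hΦ_surj : Function.Surjective Φ := by
    intro w
    have : w ∈ Φ.range := Subgroup.pi_mem_of_mulSingle_mem w fun i => ⟨_, hΦ_single i (w i)⟩
    exact this
  set T := (P : Subgroup G).subgroupOf N with hTdef
  set T₁ := ι₁.range.subgroupOf N₁ with hT₁def
  have hT₁inv : ∀ m, ∀ w ∈ T₁, σ m w ∈ T₁ := by
    intro m w hw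
    rw [hT₁def, Subgroup.mem_subgroupOf, hσ_coe]
    exact mul_mem (mul_mem ⟨m, rfl⟩ hw) (inv_mem ⟨m, rfl⟩)
  have hTP : ∀ t ∈ T, (t : G) ∈ (P : Subgroup G) := fun t ht => ht
  -- The image of P ∩ N under π is a p-subgroup of N₁ containing P ∩ N₁, whose index in N₁ is prime
  -- to p; hence the two coincide.
  have hπT : ∀ t ∈ T, π t ∈ T₁ := by
    set R := (T.map π).map N₁.subtype with hR
    have hRp : IsPGroup p R :=
      ((P.isPGroup'.comap_of_injective _ N.subtype_injective).map _).map _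
    have hRle : R ≤ N₁ := Subgroup.map_subtype_le _
    have hleR : (P : Subgroup G) ⊓ N₁ ≤ R := by
      rintro a ⟨haP, haN⟩
      exact ⟨⟨a, haN⟩, ⟨⟨a, hN₁ haN⟩, haP, hπ₁ _ haN⟩, rfl⟩
    have hNnorm : N ≤ Subgroup.normalizer (N₁ : Set G) := by
      rw [Subgroup.le_normalizer_iff]
      intro n hn a ha
      obtain ⟨c, d, hcd⟩ := hdec ⟨n, hn⟩
      simp only at hcd
      have : n * a * n⁻¹ = c * a * (c : G)⁻¹ := by
        have hd := hcomm a ha d d.2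
        rw [hcd, mul_assoc (c : G), ← hd, mul_inv_rev]
        simp [mul_assoc]
      rw [this]
      exact mul_mem (mul_mem c.2 ha) (inv_mem c.2)
    have hnd := P.not_dvd_relIndex_of_subnormal hN₁ hNnorm
    have h1 : ((P : Subgroup G) ⊓ N₁).relIndex R = 1 := by
      obtain ⟨k, hk⟩ := IsPGroup.iff_card.1 hRp
      have h2 : ((P : Subgroup G) ⊓ N₁).relIndex R ∣ p ^ k := hk ▸ Subgroup.relIndex_dvd_card _ _
      obtain ⟨l, -, hl⟩ := (Nat.dvd_prime_pow hp.out).1 h2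
      have h3 := Subgroup.relIndex_mul_relIndex _ R N₁ hleR hRle
      rw [Subgroup.inf_relIndex_right] at h3
      rcases Nat.eq_zero_or_pos l with rfl | hlpos
      · simpa using hl
      · refine absurd ?_ hnd
        rw [← h3, hl]
        exact Dvd.dvd.mul_right (dvd_pow_self p hlpos.ne') _
    rw [Subgroup.relIndex_eq_one] at h1
    intro t ht
    have h4 : ((π t : N₁) : G) ∈ R := ⟨π t, ⟨t, ht, rfl⟩, rfl⟩
    exact hPN₁ _ (π t).2 (h1 h4).1
  have hTinv : ∀ (g : (P : Subgroup G)), ∀ t ∈ T, ρ g t ∈ T := by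
    intro g t ht
    rw [hTdef, Subgroup.mem_subgroupOf, hρ_coe]
    exact mul_mem (mul_mem g.2 ht) (inv_mem g.2)
  have hT : ∀ v, v ∈ T ↔ ∀ i : Fin p, π (ρ (y ^ (i : ℕ)) v) ∈ T₁ := by
    intro v
    refine ⟨fun hv i => hπT _ (hTinv _ _ hv), fun hv => ?_⟩
    have h1 : Φ v ∈ T.map Φ := by
      refine Subgroup.pi_mem_of_mulSingle_mem _ fun i => ⟨_, hTinv _ _ ?_, hΦ_single i (Φ v i)⟩
      obtain ⟨m, hm⟩ := hv i
      rw [hTdef, Subgroup.mem_subgroupOf]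
      change ((Φ v i : N₁) : G) ∈ _
      rw [hΦ_apply]
      have h2 : ι₁ m ∈ (P : Subgroup G) := (m : (P : Subgroup G)).2
      rwa [hm] at h2
    obtain ⟨t, ht, hteq⟩ := h1
    rwa [← hΦ_inj hteq]
  rw [← hι₁_range, conjMeanInequality_range_iff p ι₁
    ((P : Subgroup G).subtype_injective.comp M.subtype_injective) N₁ σ hσ_coe] at H
  have key := TwistedMeanInequality.of_coinduced hp.out hM hy (ρ := ρ) (T := T) hT₁inv π hπ_equiv
    ⟨hΦ_inj, hΦ_surj⟩ hT H
  have h5 := conjMeanInequality_range_iff p (P : Subgroup G).subtype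
    (P : Subgroup G).subtype_injective N ρ hρ_coe
  rw [Subgroup.range_subtype] at h5
  exact h5.2 key

end

/-! ### Products of conjugates of a subgroup -/

section

variable {G : Type u} [Group G]

theorem conjMeanInequality_top_top [Finite G] {p : ℕ} (hp : 0 < p) :
    ConjMeanInequality p (⊤ : Subgroup G) ⊤ := by
  cases nonempty_fintype (⊤ : Subgroup G)
  have h : ∀ A : Set G, (conjInto ⊤ ⊤ A).ncard = Nat.card (⊤ : Subgroup G) := by
    intro A
    have : conjInto ⊤ ⊤ A = Set.univ := by ext; simp [mem_conjInto]
    rw [this, Set.ncard_univ, Subgroup.card_top]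
  rw [conjMeanInequality_iff]
  simp only [h, Finset.prod_const, Finset.card_univ, ← Nat.card_eq_fintype_card]
  obtain ⟨q, rfl⟩ : ∃ q, p = q + 1 := ⟨p - 1, by omega⟩
  exact le_of_eq (by simp only [Nat.add_sub_cancel]; ring)

theorem SylowMeanInequality.conjMeanInequality_of_sup [Finite G] {p : ℕ} [hp : Fact p.Prime]
    {N P : Subgroup G} (hP : IsPGroup p P) (h : P ≤ Subgroup.normalizer (N : Set G))
    (hnd : ¬ p ∣ P.relIndex N) (H : SylowMeanInequality p (P ⊔ N : Subgroup G)) :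
    ConjMeanInequality p N P := by
  refine ConjMeanInequality.of_sup hp.out.pos h (ConjMeanInequality.of_subgroupOf le_sup_left ?_)
  have hP' : IsPGroup p (P.subgroupOf (P ⊔ N)) :=
    hP.comap_of_injective _ (Subgroup.subtype_injective _)
  have hnd' : ¬ p ∣ (P.subgroupOf (P ⊔ N)).index := by
    rwa [← Subgroup.relIndex_sup_of_le_normalizer h] at hnd
  -- The index of P in PN equals that of P ∩ N in N, so P is Sylow in PN.
  exact sylowMeanInequality_iff.1 H (hP'.toSylow hnd')

/-- The subgroup generated by the conjugates of `S` by the elements of `A`. -/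
def Subgroup.closureConj (S : Subgroup G) (A : Set G) : Subgroup G :=
  Subgroup.closure {x | ∃ a ∈ A, ∃ s ∈ S, x = a * s * a⁻¹}

theorem Subgroup.closureConj_le {S K : Subgroup G} {A : Set G}
    (h : ∀ a ∈ A, ∀ s ∈ S, a * s * a⁻¹ ∈ K) : S.closureConj A ≤ K := by
  rw [Subgroup.closureConj, Subgroup.closure_le]
  rintro _ ⟨a, ha, s, hs, rfl⟩
  exact h a ha s hs

theorem Subgroup.mem_closureConj {S : Subgroup G} {A : Set G} {a s : G} (ha : a ∈ A) (hs : s ∈ S) :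
    a * s * a⁻¹ ∈ S.closureConj A :=
  Subgroup.subset_closure ⟨a, ha, s, hs, rfl⟩

theorem Subgroup.conj_mem_closureConj {S : Subgroup G} {A B : Set G} {h : G}
    (hAB : ∀ a ∈ A, h * a ∈ B) {x : G} (hx : x ∈ S.closureConj A) :
    h * x * h⁻¹ ∈ S.closureConj B := by
  have : S.closureConj A ≤ (S.closureConj B).comap (MulAut.conj h).toMonoidHom := by
    refine Subgroup.closureConj_le fun a ha s hs => ?_
    have := Subgroup.mem_closureConj (hAB a ha) hs
    simpa [mul_assoc] using this
  simpa using this hx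

theorem Subgroup.le_normalizer_closureConj {S N : Subgroup G} [N.Normal] (A : Set G)
    (hN : N ≤ Subgroup.normalizer (S : Set G)) :
    N ≤ Subgroup.normalizer (S.closureConj A : Set G) := by
  rw [Subgroup.le_normalizer_iff] at hN ⊢
  intro n hn x hx
  have : S.closureConj A ≤ (S.closureConj A).comap (MulAut.conj n).toMonoidHom := by
    refine Subgroup.closureConj_le fun a ha s hs => ?_
    have h1 : a⁻¹ * n * a ∈ N := by simpa using Subgroup.Normal.conj_mem ‹_› n hn a⁻¹
    have := Subgroup.mem_closureConj ha (hN _ h1 s hs)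
    simpa [mul_assoc] using this
  simpa using this hx

theorem Subgroup.commute_closureConj {S : Subgroup G} {A B : Set G}
    (h : ∀ a ∈ A, ∀ b ∈ B, ∀ s ∈ S, ∀ t ∈ S, Commute s ((a⁻¹ * b) * t * (a⁻¹ * b)⁻¹)) :
    ∀ x ∈ S.closureConj A, ∀ y ∈ S.closureConj B, x * y = y * x := by
  have h1 : S.closureConj A ≤ Subgroup.centralizer (S.closureConj B) := by
    refine Subgroup.closureConj_le fun a ha s hs => ?_
    rw [Subgroup.closureConj, Subgroup.centralizer_closure, Subgroup.mem_centralizer_iff]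
    rintro _ ⟨b, hb, t, ht, rfl⟩
    have := congrArg (fun u => a * u * a⁻¹) (h a ha b hb s hs t ht).eq
    simpa [mul_assoc] using this.symm
  intro x hx y hy
  exact (Subgroup.mem_centralizer_iff.1 (h1 hx) y hy).symm

end

/-! ### Minimal normal subgroups with a p-group quotient -/

section

variable {G : Type u} [Group G]

theorem Subgroup.normal_of_sup_eq_top {P N K : Subgroup G} (h : P ⊔ N = ⊤)
    (hP : P ≤ Subgroup.normalizer (K : Set G)) (hN : N ≤ Subgroup.normalizer (K : Set G)) :
    K.Normal :=
  Subgroup.normalizer_eq_top_iff.1 (top_le_iff.1 (h ▸ sup_le hP hN))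

theorem ConjMeanInequality.of_minimal_abelian [Finite G] {p : ℕ} [Fact p.Prime] (P : Sylow p G)
    {N : Subgroup G} [N.Normal] (hPtop : (P : Subgroup G) ≠ ⊤) (hPN : (P : Subgroup G) ⊔ N = ⊤)
    (hmin : ∀ K ≤ N, K.Normal → K = ⊥ ∨ K = N) (hcomm : ∀ a ∈ N, ∀ b ∈ N, a * b = b * a) :
    ConjMeanInequality p N (P : Subgroup G) := by
  have hNnorm : ∀ K ≤ N, N ≤ Subgroup.normalizer (K : Set G) := by
    intro K hK
    rw [Subgroup.le_normalizer_iff]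
    intro n hn k hk
    rwa [hcomm n hn k (hK hk), mul_inv_cancel_right]
  -- P ∩ N is normalized by P and by the abelian group N, hence normal in G; were it N, then P = PN
  -- = G.
  have hinf : (P : Subgroup G) ⊓ N = ⊥ := by
    refine (hmin _ inf_le_right (Subgroup.normal_of_sup_eq_top hPN ?_
      (hNnorm _ inf_le_right))).resolve_right ?_
    · rw [Subgroup.le_normalizer_iff]
      rintro g hg k ⟨hkP, hkN⟩
      exact ⟨Subgroup.mul_mem _ (Subgroup.mul_mem _ hg hkP) (Subgroup.inv_mem _ hg), Subgroup.Normal.conj_mem ‹_› k hkN g⟩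
    · intro h
      rw [sup_eq_left.2 (inf_eq_right.1 h)] at hPN
      exact hPtop hPN
  set ρ : (P : Subgroup G) →* MulAut N := MulAut.conjNormal.comp (P : Subgroup G).subtype with hρ
  have hρ_coe : ∀ (x : (P : Subgroup G)) (n : N), (ρ x n : G) = x * n * (x : G)⁻¹ :=
    fun x n => MulAut.conjNormal_apply _ _
  have key := conjMeanInequality_range_iff p (P : Subgroup G).subtype
    (P : Subgroup G).subtype_injective N ρ hρ_coe
  have hbot : (P : Subgroup G).subgroupOf N = ⊥ := by
    rw [Subgroup.subgroupOf_eq_bot, disjoint_iff, hinf]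
  rw [Subgroup.range_subtype, hbot] at key
  rw [key]
  refine TwistedMeanInequality.of_abelian P.isPGroup'
    (fun a b => Subtype.ext (hcomm a a.2 b b.2)) ρ fun z hz => ?_
  -- The fixed points of z in N form a normal subgroup of G because z acts centrally, so minimality
  -- leaves only 1 and N.
  set K : Subgroup G := N ⊓ Subgroup.centralizer {(z : G)} with hK
  have hmemK : ∀ v : N, (v : G) ∈ K ↔ ρ z v = v := by
    intro v
    rw [hK, Subgroup.mem_inf, Subgroup.mem_centralizer_singleton_iff, Subtype.ext_iff, hρ_coe,
      mul_inv_eq_iff_eq_mul]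
    exact ⟨fun h => h.2.symm, fun h => ⟨v.2, h.symm⟩⟩
  have hKn : K.Normal := by
    refine Subgroup.normal_of_sup_eq_top hPN ?_ (hNnorm _ inf_le_left)
    rw [Subgroup.le_normalizer_iff]
    rintro g hg k hk
    have h1 := (hmemK ⟨k, hk.1⟩).1 hk
    have h2 := DFunLike.congr_fun (hz ⟨g, hg⟩).eq ⟨k, hk.1⟩
    rw [MulAut.mul_apply, MulAut.mul_apply, h1] at h2
    have h3 := (hmemK _).2 h2.symm
    rwa [hρ_coe] at h3
  rcases hmin K inf_le_left hKn with h | h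
  · right
    intro v hv
    have := (hmemK v).2 hv
    rw [h, Subgroup.mem_bot] at this
    exact Subtype.ext this
  · left
    refine MulEquiv.ext fun v => (hmemK v).1 ?_
    rw [h]
    exact v.2

theorem IsAlmostSimple.of_minimal_nonabelian {N : Subgroup G} [N.Normal]
    (hmin : ∀ K ≤ N, N ≤ Subgroup.normalizer (K : Set G) → K = ⊥ ∨ K = N)
    (hcomm : ¬ ∀ a ∈ N, ∀ b ∈ N, a * b = b * a) (hC : Subgroup.centralizer (N : Set G) = ⊥) :
    IsAlmostSimple G := by
  push Not at hcomm
  obtain ⟨a, ha, b, hb, hab⟩ := hcomm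
  have hnt : Nontrivial N :=
    ⟨⟨⟨a, ha⟩, 1, fun h => hab (by rw [show a = 1 from congrArg Subtype.val h]; simp)⟩⟩
  refine ⟨N, inferInstance, ⟨fun K hK => ?_⟩, ⟨⟨a, ha⟩, ⟨b, hb⟩, fun h => hab ?_⟩,
    MulAut.conjNormal, ?_, ?_⟩
  · have hKn : N ≤ Subgroup.normalizer (K.map N.subtype : Set G) := by
      rw [Subgroup.le_normalizer_iff]
      rintro n hn _ ⟨k, hk, rfl⟩
      exact ⟨⟨n, hn⟩ * k * ⟨n, hn⟩⁻¹, hK.conj_mem k hk _, by simp⟩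
    rcases hmin (K.map N.subtype) (Subgroup.map_subtype_le K) hKn with h | h
    · left
      exact (Subgroup.map_eq_bot_iff_of_injective _ N.subtype_injective).1 h
    · right
      refine Subgroup.map_injective N.subtype_injective ?_
      rw [h, ← MonoidHom.range_eq_map, Subgroup.range_subtype]
  · exact congrArg Subtype.val h
  · rw [injective_iff_map_eq_one]
    intro g hg
    have : g ∈ Subgroup.centralizer (N : Set G) := by
      rw [Subgroup.mem_centralizer_iff]
      intro n hn
      have h1 := congrArg Subtype.val (DFunLike.congr_fun hg ⟨n, hn⟩)
      rw [MulAut.conjNormal_apply, MulAut.one_apply, mul_inv_eq_iff_eq_mul] at h1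
      exact h1.symm
    rwa [hC, Subgroup.mem_bot] at this
  · rintro _ ⟨n, rfl⟩
    exact ⟨n, MulAut.conjNormal_val⟩

/-- P cannot normalize S, for S would then be normal in PN = G. A normal subgroup M of index p
containing the normalizer of S in P separates the conjugates of S into commuting blocks. -/
theorem ConjMeanInequality.of_minimal_nonsimple [Finite G] {p : ℕ} [hp : Fact p.Prime]
    (P : Sylow p G) {N S : Subgroup G} [N.Normal] (hPN : (P : Subgroup G) ⊔ N = ⊤)
    (hmin : ∀ K ≤ N, K.Normal → K = ⊥ ∨ K = N) (hcomm : ¬ ∀ a ∈ N, ∀ b ∈ N, a * b = b * a)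
    (hSN : S ≤ N) (hS : S ≠ ⊥) (hSne : S ≠ N) (hNS : N ≤ Subgroup.normalizer (S : Set G))
    (hSmin : ∀ K ≤ S, N ≤ Subgroup.normalizer (K : Set G) → K = ⊥ ∨ K = S)
    (IH : ∀ K : Subgroup G, K ≠ ⊤ → SylowMeanInequality p K) :
    ConjMeanInequality p N (P : Subgroup G) := by
  have hZ : ∀ z ∈ N, (∀ n ∈ N, z * n = n * z) → z = 1 := by
    have h1 : N ⊓ Subgroup.centralizer (N : Set G) = ⊥ := by
      refine (hmin _ inf_le_left inferInstance).resolve_right fun h => hcomm ?_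
      intro a ha b hb
      exact (Subgroup.mem_centralizer_iff.1 (inf_eq_left.1 h ha) b hb).symm
    intro z hz hzn
    have : z ∈ N ⊓ Subgroup.centralizer (N : Set G) :=
      ⟨hz, Subgroup.mem_centralizer_iff.2 fun n hn => (hzn n hn).symm⟩
    rwa [h1, Subgroup.mem_bot] at this
  have hHtop : (Subgroup.normalizer (S : Set G)).subgroupOf (P : Subgroup G) ≠ ⊤ := by
    intro h
    rw [Subgroup.subgroupOf_eq_top] at h
    rcases hmin S hSN (Subgroup.normal_of_sup_eq_top hPN h hNS) with h | h
    · exact hS h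
    · exact hSne h
  obtain ⟨M, hHM, hMn, hM⟩ := P.isPGroup'.exists_normal_index_eq_of_ne_top hHtop
  set M' : Subgroup G := M.map (P : Subgroup G).subtype with hM'
  have hM'P : M' ≤ P := Subgroup.map_subtype_le M
  have hmemM : ∀ g : (P : Subgroup G), (g : G) ∈ M' ↔ g ∈ M := fun g =>
    Subgroup.mem_map_iff_mem (P : Subgroup G).subtype_injective
  set B : Set G := {g | g ∈ (P : Subgroup G) ∧ g ∉ M'} with hB
  have hPMN : ∀ g ∈ (P : Subgroup G), g ∈ Subgroup.normalizer (S : Set G) → g ∈ M' := by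
    intro g hg hgS
    exact (hmemM ⟨g, hg⟩).2 (hHM hgS)
  have hconjN : ∀ g : G, ∀ s ∈ S, g * s * g⁻¹ ∈ N := fun g s hs =>
    Subgroup.Normal.conj_mem ‹_› s (hSN hs) g
  -- Conjugates of `S` by elements in different cosets of `M'` commute.
  have hSS : ∀ k ∈ (P : Subgroup G), k ∉ M' → ∀ s ∈ S, ∀ t ∈ S, Commute s (k * t * k⁻¹) := by
    intro k hkP hkM s hs t ht
    set R : Subgroup G := S.map (MulAut.conj k).toMonoidHom with hR
    have hmemR : ∀ x, x ∈ R ↔ k⁻¹ * x * k ∈ S := by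
      intro x
      constructor
      · rintro ⟨r, hr, rfl⟩
        simpa [mul_assoc] using hr
      · intro h
        exact ⟨_, h, by simp [mul_assoc]⟩
    rw [Subgroup.le_normalizer_iff] at hNS
    have hNR : ∀ n ∈ N, ∀ r ∈ R, n * r * n⁻¹ ∈ R := by
      intro n hn r hr
      rw [hmemR] at hr ⊢
      have h1 : k⁻¹ * n * k ∈ N := by simpa using Subgroup.Normal.conj_mem ‹_› n hn k⁻¹
      have := hNS _ h1 _ hr
      simpa [mul_assoc] using this
    have hinf : S ⊓ R = ⊥ := by
      refine (hSmin _ inf_le_left ?_).resolve_right fun h => hkM (hPMN k hkP ?_)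
      · rw [Subgroup.le_normalizer_iff]
        rintro n hn r ⟨hrS, hrR⟩
        exact ⟨hNS n hn r hrS, hNR n hn r hrR⟩
      · have hcard : Nat.card R = Nat.card S :=
          Subgroup.card_map_of_injective (MulAut.conj k).injective
        have hSR : S = R := Subgroup.eq_of_le_of_card_ge (inf_eq_left.1 h) hcard.le
        rw [Subgroup.mem_normalizer_iff'']
        intro x
        rw [← hmemR, ← hSR]
    have hktN : k * t * k⁻¹ ∈ N := hconjN k t ht
    have hktR : k * t * k⁻¹ ∈ R := ⟨t, ht, by simp⟩
    -- S and its conjugate R are both normalized by N, so commutators between them lie in S ∩ R = 1.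
    have h1 : s * (k * t * k⁻¹) * s⁻¹ * (k * t * k⁻¹)⁻¹ ∈ S ⊓ R := by
      refine ⟨?_, R.mul_mem (hNR s (hSN hs) _ hktR) (R.inv_mem hktR)⟩
      have h2 := S.mul_mem hs (hNS _ hktN _ (S.inv_mem hs))
      rwa [← mul_assoc, ← mul_assoc] at h2
    rw [hinf, Subgroup.mem_bot, mul_inv_eq_one, mul_inv_eq_iff_eq_mul] at h1
    exact h1
  set N₁ := S.closureConj M' with hN₁
  set N' := S.closureConj B with hN'
  have hSN₁ : S ≤ N₁ := fun s hs => by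
    simpa using Subgroup.mem_closureConj (S := S) (one_mem M' : (1 : G) ∈ (M' : Set G)) hs
  have hunion : N₁ ⊔ N' = S.closureConj (P : Subgroup G) := by
    refine le_antisymm (sup_le ?_ ?_) ?_
    · exact Subgroup.closureConj_le fun a ha s hs => Subgroup.mem_closureConj (hM'P ha) hs
    · exact Subgroup.closureConj_le fun a ha s hs => Subgroup.mem_closureConj ha.1 hs
    · refine Subgroup.closureConj_le fun a ha s hs => ?_
      by_cases haM : a ∈ M'
      · exact Subgroup.mem_sup_left (Subgroup.mem_closureConj haM hs)
      · exact Subgroup.mem_sup_right (Subgroup.mem_closureConj ⟨ha, haM⟩ hs)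
  have hall : S.closureConj ((P : Subgroup G) : Set G) = N := by
    refine (hmin _ (Subgroup.closureConj_le fun a _ s hs => hconjN a s hs)
      (Subgroup.normal_of_sup_eq_top hPN ?_
        (Subgroup.le_normalizer_closureConj _ hNS))).resolve_left fun h => hS ?_
    · rw [Subgroup.le_normalizer_iff]
      intro g hg x hx
      exact Subgroup.conj_mem_closureConj (fun a ha => mul_mem hg ha) hx
    · rw [← le_bot_iff, ← h, ← hunion]
      exact hSN₁.trans le_sup_left
  have hsup : N₁ ⊔ N' = N := hunion.trans hall
  have hcomm' : ∀ a ∈ N₁, ∀ b ∈ N', a * b = b * a := by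
    refine Subgroup.commute_closureConj fun a ha b hb => hSS _ ?_ ?_
    · exact mul_mem (inv_mem (hM'P ha)) hb.1
    · exact fun h => hb.2 ((Subgroup.mul_mem_cancel_left _ (inv_mem ha)).1 h)
  have hinf : N₁ ⊓ N' = ⊥ := by
    rw [eq_bot_iff]
    rintro z ⟨hz₁, hz'⟩
    refine hZ z (hsup ▸ Subgroup.mem_sup_left hz₁) fun n hn => ?_
    have : N ≤ Subgroup.centralizer {z} := by
      rw [← hsup]
      refine sup_le (fun a ha => ?_) fun b hb => ?_
      · exact Subgroup.mem_centralizer_singleton_iff.2 (hcomm' a ha z hz')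
      · exact Subgroup.mem_centralizer_singleton_iff.2 (hcomm' z hz₁ b hb).symm
    exact (Subgroup.mem_centralizer_singleton_iff.1 (this hn)).symm
  have hMN₁ : M' ≤ Subgroup.normalizer (N₁ : Set G) := by
    rw [Subgroup.le_normalizer_iff]
    exact fun g hg x hx => Subgroup.conj_mem_closureConj (fun a ha => mul_mem hg ha) hx
  have hN₁N : N₁ ≤ N := hsup ▸ le_sup_left
  have hrel : M'.relIndex N₁ = (P : Subgroup G).relIndex N₁ := by
    rw [← Subgroup.inf_relIndex_right M', ← Subgroup.inf_relIndex_right (P : Subgroup G)]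
    congr 1
    refine le_antisymm (inf_le_inf_right _ hM'P) ?_
    rintro x ⟨hxP, hxN⟩
    exact ⟨hPMN x hxP (hNS (hN₁N hxN)), hxN⟩
  have hnd : ¬ p ∣ M'.relIndex N₁ := by
    rw [hrel]
    exact P.not_dvd_relIndex_of_subnormal hN₁N (Subgroup.le_normalizer_closureConj _ hNS)
  -- The index of M' in M'N₁ is prime to p, whereas its index in G is divisible by [P : M'] = p.
  have hne : M' ⊔ N₁ ≠ ⊤ := by
    intro h
    rw [← Subgroup.relIndex_sup_of_le_normalizer hMN₁, h, Subgroup.relIndex_top_right,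
      ← Subgroup.relIndex_mul_index hM'P] at hnd
    apply hnd
    have h1 : M'.relIndex (P : Subgroup G) = p := by
      rw [Subgroup.relIndex, hM', Subgroup.subgroupOf, Subgroup.comap_map_eq_self_of_injective
        (P : Subgroup G).subtype_injective, hM]
    rw [h1]
    exact dvd_mul_right _ _
  have hH := SylowMeanInequality.conjMeanInequality_of_sup (P.isPGroup'.to_le hM'P) hMN₁ hnd
    (IH _ hne)
  refine ConjMeanInequality.of_directFactor P hM hsup hinf hcomm' ?_ ?_ ?_ ?_ hH
  · intro m hm a ha
    exact Subgroup.conj_mem_closureConj (fun g hg => mul_mem ((hmemM m).2 hm) hg) ha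
  · intro m hm a ha
    refine Subgroup.conj_mem_closureConj (B := B)
      (fun g hg => ⟨mul_mem m.2 hg.1, fun h => hg.2 ?_⟩) ha
    exact (Subgroup.mul_mem_cancel_left _ ((hmemM m).2 hm)).1 h
  · intro g hg a ha
    refine Subgroup.conj_mem_closureConj (B := B)
      (fun k hk => ⟨mul_mem g.2 (hM'P hk), fun h => hg ?_⟩) ha
    exact (hmemM g).1 ((Subgroup.mul_mem_cancel_right _ hk).1 h)
  · intro z hz hzc
    refine hZ z hz fun n hn => ?_
    have : N ≤ Subgroup.centralizer {z} := by
      rw [← hall]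
      refine Subgroup.closureConj_le fun a ha s hs => ?_
      exact Subgroup.mem_centralizer_singleton_iff.2 (hzc ⟨a, ha⟩ s (hSN₁ hs)).eq.symm
    exact (Subgroup.mem_centralizer_singleton_iff.1 (this hn)).symm

/-! ### The induction on the order of the group -/

theorem SylowMeanInequality.of_forall_isAlmostSimple {p : ℕ} [hp : Fact p.Prime]
    (H : ∀ (G : Type u) [Group G] [Finite G], IsAlmostSimple G → SylowMeanInequality p G) :
    ∀ (n : ℕ) (G : Type u) [Group G] [Finite G], Nat.card G = n → SylowMeanInequality p G := by
  intro n
  induction n using Nat.strong_induction_on with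
  | _ n IH =>
  intro G _ _ hG
  subst hG
  have IHsub : ∀ K : Subgroup G, K ≠ ⊤ → SylowMeanInequality p K := fun K hK =>
    IH _ (lt_of_le_of_ne (Subgroup.card_le_card_group K)
      fun h => hK ((Subgroup.card_eq_iff_eq_top K).1 h)) K rfl
  rw [sylowMeanInequality_iff]
  intro P
  by_cases hPtop : (P : Subgroup G) = ⊤
  · rw [hPtop]
    exact conjMeanInequality_top_top hp.out.pos
  by_cases hex : ∃ N : Subgroup G, N.Normal ∧ N ≠ ⊥ ∧ (P : Subgroup G) ⊔ N ≠ ⊤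
  · obtain ⟨N, hN, hN1, hPN⟩ := hex
    refine ConjMeanInequality.of_quotient N P ?_ ?_
    · have hlt : Nat.card (G ⧸ N) < Nat.card G := by
        rw [Subgroup.card_eq_card_quotient_mul_card_subgroup N]
        have h1 : 1 < Nat.card N := Subgroup.one_lt_card_iff_ne_bot N |>.2 hN1
        exact lt_mul_of_one_lt_right Nat.card_pos h1
      exact sylowMeanInequality_iff.1 (IH _ hlt (G ⧸ N) rfl)
        (P.mapSurjective (QuotientGroup.mk'_surjective N))
    · exact (IHsub _ hPN).conjMeanInequality_of_sup P.isPGroup' Subgroup.le_normalizer_of_normal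
        (P.not_dvd_relIndex_of_subnormal le_rfl Subgroup.le_normalizer)
  push Not at hex
  have hGnt : (⊤ : Subgroup G) ≠ ⊥ := fun h => hPtop (top_le_iff.1 (h ▸ bot_le))
  obtain ⟨N, hNmin⟩ := (Set.toFinite {N : Subgroup G | N.Normal ∧ N ≠ ⊥}).exists_minimal
    ⟨⊤, inferInstance, hGnt⟩
  obtain ⟨hN, hN1⟩ := hNmin.prop
  have hPN := hex N hN hN1
  have hmin : ∀ K ≤ N, K.Normal → K = ⊥ ∨ K = N := by
    intro K hK hKn
    by_cases hK1 : K = ⊥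
    · exact Or.inl hK1
    · exact Or.inr (le_antisymm hK (hNmin.le_of_le ⟨hKn, hK1⟩ hK))
  have hmap : (P : Subgroup G).map (QuotientGroup.mk' N) = ⊤ := by
    have h1 : (P : Subgroup G).map (QuotientGroup.mk' N) =
        (⊤ : Subgroup G).map (QuotientGroup.mk' N) := by
      rw [Subgroup.map_eq_map_iff, QuotientGroup.ker_mk', hPN, top_sup_eq]
    rw [h1, ← MonoidHom.range_eq_map,
      MonoidHom.range_eq_top.2 (QuotientGroup.mk'_surjective N)]
  have hred : ConjMeanInequality p N (P : Subgroup G) →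
      ConjMeanInequality p ⊤ (P : Subgroup G) := fun h => by
    refine ConjMeanInequality.of_quotient N P ?_ h
    rw [hmap]
    exact conjMeanInequality_top_top hp.out.pos
  by_cases hcomm : ∀ a ∈ N, ∀ b ∈ N, a * b = b * a
  · exact hred (ConjMeanInequality.of_minimal_abelian P hPtop hPN hmin hcomm)
  obtain ⟨S, hSmin⟩ := (Set.toFinite
    {S : Subgroup G | S ≤ N ∧ S ≠ ⊥ ∧ N ≤ Subgroup.normalizer (S : Set G)}).exists_minimal
    ⟨N, le_rfl, hN1, Subgroup.le_normalizer⟩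
  obtain ⟨hSN, hS, hNS⟩ := hSmin.prop
  have hSmin' : ∀ K ≤ S, N ≤ Subgroup.normalizer (K : Set G) → K = ⊥ ∨ K = S := by
    intro K hK hKn
    by_cases hK1 : K = ⊥
    · exact Or.inl hK1
    · exact Or.inr (le_antisymm hK (hSmin.le_of_le ⟨hK.trans hSN, hK1, hKn⟩ hK))
  by_cases hSne : S = N
  · subst hSne
    refine sylowMeanInequality_iff.1 (H G (.of_minimal_nonabelian hSmin' hcomm ?_)) P
    -- The centralizer meets N trivially, so it embeds in the p-group G/N. Being a normal p-subgroup
    -- it lies in P, and a nontrivial one would give G = P.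
    by_contra hC
    have hPC := hex _ inferInstance hC
    have hdisj : S ⊓ Subgroup.centralizer (S : Set G) = ⊥ := by
      refine (hmin _ inf_le_left inferInstance).resolve_right fun h => hcomm ?_
      intro a ha b hb
      exact (Subgroup.mem_centralizer_iff.1 (inf_eq_left.1 h ha) b hb).symm
    have hquot : IsPGroup p (G ⧸ S) := by
      refine P.isPGroup'.of_surjective ((QuotientGroup.mk' S).comp (P : Subgroup G).subtype) ?_
      rw [← MonoidHom.range_eq_top, MonoidHom.range_comp, Subgroup.range_subtype, hmap]
    have hCp : IsPGroup p (Subgroup.centralizer (S : Set G)) := by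
      refine hquot.of_injective
        ((QuotientGroup.mk' S).comp (Subgroup.centralizer (S : Set G)).subtype) ?_
      rw [injective_iff_map_eq_one]
      intro c hc
      have h1 : (c : G) ∈ S ⊓ Subgroup.centralizer (S : Set G) :=
        ⟨(QuotientGroup.eq_one_iff _).1 hc, c.2⟩
      rw [hdisj, Subgroup.mem_bot] at h1
      exact Subtype.ext h1
    rw [sup_eq_left.2 (hCp.le_sylow_of_normal P)] at hPC
    exact hPtop hPC
  · exact hred (ConjMeanInequality.of_minimal_nonsimple P hPN hmin hcomm hSN hS hSne hNS hSmin'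
      IHsub)

end

theorem theorem1p2 (p : ℕ) (hp : p.Prime) :
    (∀ (G : Type u) [Group G] [Finite G], SylowMeanInequality p G) ↔
      (∀ (G : Type u) [Group G] [Finite G], IsAlmostSimple G → SylowMeanInequality p G) := by
  have := Fact.mk hp
  exact ⟨fun h G _ _ _ => h G,
    fun h G _ _ => SylowMeanInequality.of_forall_isAlmostSimple h _ G rfl⟩
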